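/- Let $R$ be a real random variable with $\mathbb{E}R=0$ and $\mathbb{E}R^2=1$, and let $R_1,R_2,\dots$ be independent copies of $R$. For every $d\in\mathbb{N}$ let $V_1^{(d)},V_2^{(d)},\dots$ be i.i.d. random vectors uniformly distributed on the standard basis $\{e_1,\dots,e_d\}$ of $\mathbb{R}^d$, with $(R_i)_{i\ge1}$ and $(V_i^{(d)})_{i\ge1}$ independent. Put $S_n^{(d)}=\sum_{i=1}^n R_iV_i^{(d)}$, let $n=n(d)$ be any sequence of positive integers with $n(d)\to\infty$ as $d\to\infty$, and let $\|\cdot\|$ be the Euclidean norm. Below, $\Rightarrow$ denotes convergence in distribution as $d\to\infty$, and $\mathrm{N}(0,\sigma^2)$ the centered normal law with variance $\sigma^2$ (the unit mass at $0$ if $\sigma^2=0$). (I) Suppose that $\mathbb{E}R^4<\infty$. (a) If $n/d\to0$, then $\dfrac{\|S_n^{(d)}\|^2-n}{\sqrt n}\Rightarrow \mathrm{N}(0,\operatorname{Var}(R^2))$. (b) If $n/d\to\infty$, then $\dfrac{\|S_n^{(d)}\|^2-n}{\sqrt{2n^2/d}}\Rightarrow \mathrm{N}(0,1)$. (c) If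 $n\sim\gamma d$ for some constant $\gamma\in(0,\infty)$, then $\dfrac{\|S_n^{(d)}\|^2-n}{\sqrt n}\Rightarrow \mathrm{N}(0,2\gamma+\operatorname{Var}(R^2))$. (II) Suppose instead that, for some $\alpha\in(1,2)$, some function $L$ slowly varying at infinity and some zero-mean random variable $\zeta_\alpha$ with a spectrally positive $\alpha$-stable distribution (that is, for some $\sigma>0$, $\mathbb{E}e^{it\zeta_\alpha}=\exp\bigl(-\sigma^\alpha|t|^\alpha(1-i\,\mathrm{sgn}(t)\tan\tfrac{\pi\alpha}{2})\bigr)$ for all $t\in\mathbb{R}$), the random variables $\dfrac{R_1^2+\dots+R_m^2-m}{m^{1/\alpha}L(m)}$ converge in distribution to $\zeta_\alpha$ as $m\to\infty$. (a) If there is $\delta>0$ such that $n>d^{\frac{\alpha}{2\alpha-2}+\delta}$ for all sufficiently large $d$, then $\dfrac{\|S_n^{(d)}\|^2-n}{\sqrt{2n^2/d}}\Rightarrow \mathrm{N}(0,1)$. (b) If there is $\delta>0$ such that $n<d^{\frac{\alpha}{2\alpha-2}-\delta}$ for all sufficiently large $d$, then $\dfrac{\|S_n^{(d)}\|^2-n}{n^{1/\alpha}L(n)}\Rightarrow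 \zeta_\alpha$. -/

import Mathlib

open MeasureTheory ProbabilityTheory Filter Topology Asymptotics

noncomputable section

/-- The random walk jumping along the coordinate axes. For every dimension `d` the increments are
`R i • V d i`, where `R 0, R 1, …` are independent copies of a real random variable `R₀` with
`E R₀ = 0`, `E R₀² = 1`, the vectors `V d 0, V d 1, …` are i.i.d. and uniformly distributed on the
standard basis of `ℝ^d`, and the two sequences are independent.
(As `E R₀² = 1 ≠ 0`, the variable `R₀` is automatically square integrable, hence integrable.) -/
structure IsAxisWalkModel {Ω₀ Ω : Type*} [MeasurableSpace Ω₀] [MeasurableSpace Ω]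
    (P₀ : Measure Ω₀) (P : Measure Ω) (R₀ : Ω₀ → ℝ) (R : ℕ → Ω → ℝ)
    (V : (d : ℕ) → ℕ → Ω → EuclideanSpace ℝ (Fin d)) : Prop where
  mean_zero : ∫ ω, R₀ ω ∂P₀ = 0
  second_moment : ∫ ω, R₀ ω ^ 2 ∂P₀ = 1
  measurable_R : ∀ i, Measurable (R i)
  identDistrib_R : ∀ i, IdentDistrib (R i) R₀ P P₀
  indep_R : iIndepFun R P
  measurable_V : ∀ d i, Measurable (V d i)
  uniform_V : ∀ (d i : ℕ) (j : Fin d),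
    P {ω | V d i ω = EuclideanSpace.single j (1 : ℝ)} = (d : ENNReal)⁻¹
  indep_V : ∀ d, iIndepFun (V d) P
  indep_R_V : ∀ d, IndepFun (fun ω i => R i ω) (fun ω i => V d i ω) P

/-- The position `S_n^{(d)}` after `n` steps. -/
def axisWalk {Ω : Type*} (R : ℕ → Ω → ℝ) (V : (d : ℕ) → ℕ → Ω → EuclideanSpace ℝ (Fin d))
    (d n : ℕ) (ω : Ω) : EuclideanSpace ℝ (Fin d) :=
  ∑ i ∈ Finset.range n, R i ω • V d i ω

/-- The random variables `X m` on `(Ω, P)` converge in distribution to the probability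
law `ν` as `m → ∞`. -/
def ConvergesInLaw {Ω : Type*} [MeasurableSpace Ω] (P : Measure Ω) [IsProbabilityMeasure P]
    (X : ℕ → Ω → ℝ) (ν : Measure ℝ) [IsProbabilityMeasure ν] : Prop :=
  TendstoInDistribution (Ω := fun _ => Ω) X atTop (id : ℝ → ℝ) (fun _ => P) ν

/-- `L` is slowly varying at infinity. -/
structure IsSlowlyVarying (L : ℝ → ℝ) : Prop where
  measurable : Measurable L
  eventually_pos : ∀ᶠ x in atTop, 0 < L x
  tendsto_ratio : ∀ c : ℝ, 0 < c → Tendsto (fun x => L (c * x) / L x) atTop (𝓝 1)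

/-- For `α ∈ (1, 2)`: `ν` is a zero-mean spectrally positive `α`-stable law, that is, the stable
law with index `α`, some scale `σ > 0`, skewness `1` and location (mean) `0`. -/
def IsCenteredSpectrallyPositiveStable (α : ℝ) (ν : Measure ℝ) : Prop :=
  ∃ σ : ℝ, 0 < σ ∧ ∀ t : ℝ, charFun ν t =
    Complex.exp (-(((σ * |t|) ^ α : ℝ) : ℂ) *
      (1 - Complex.I * ((Real.sign t * Real.tan (Real.pi * α / 2) : ℝ) : ℂ)))

end

/-! ### The squared norm as a sum of squares plus a collision martingale -/

noncomputable section

set_option linter.unusedSectionVars false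

/-! Let `W_k` be the coordinate of the walk, before step `k`, in the direction chosen by step `k`.
Adding one step at a time gives `‖S_n‖² = ∑ R_k² + 2 ∑ R_k W_k`. Here `R_k` is independent of the
past and of the direction, so `∑ (R_k² - 1)` and `∑ R_k W_k` are both martingales. With `s` denoting
the second moment of a step, `E W_k² = s k / d`. For `s = 1` the collision part `2 ∑ R_k W_k`
therefore has variance about `2 n² / d`, to be compared with `n Var(R²)` for the first part. The
regimes of the theorem say which of the two dominates.

For the normal limits, take weights `a`, `b` and the increments `Y_k = a (R_k² - s) + 2 b R_k W_k`.
The conditional variance of `Y_k` given the past is `a² Var(R²)` plus a multiple of `(1/d) ∑_{i<k}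
R_i` plus a multiple of `(1/d) ‖S_k‖²`. The second term is small, and the third concentrates at its
mean because `‖S_k‖²` obeys the same decomposition. So the conditional variance is nearly
deterministic, and the characteristic function of `∑ Y_k` is compared with the normal one step by
step (`norm_integral_mul_exp_sub_le`, `norm_charFun_sub_le`). Conditional expectations enter only as
integrals against bounded past-measurable `Z`.

The remainder estimate needs fourth moments of `W_k`, hence bounded steps. General steps are
truncated and recentred (`exists_bounded_centered_approx`), and martingale orthogonality bounds the
replacement error in `L²` uniformly in large `d`. For `a = 0` only second moments of `R` enter. The
outcome is `eventually_norm_charFun_sub_lt`.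

In the stable case the collision part is of order `n / √d` and the sum of squares of order `n^(1/α)
L(n)`. These balance at `n = d^(α/(2α-2))` up to slowly varying factors, and the bounds `x^(-ε) ≤
L(x) ≤ x^ε` show that a margin `δ` in the exponent makes one part negligible. The other part has its
limit by the central limit theorem with `a = 0`, or by hypothesis. -/

/-- A driving noise for the axis walk: at time `k` the walk moves by `R k` along the coordinate
`J k`, where `R k` has law `μ`, the index `J k` is uniform on `Fin d`, and both are independent of
each other and of the past `F k`. -/
structure IsAxisNoise {Ω : Type*} [mΩ : MeasurableSpace Ω] (P : Measure Ω) {d : ℕ}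
    (F : ℕ → MeasurableSpace Ω) (J : ℕ → Ω → Fin d) (R : ℕ → Ω → ℝ) (μ : Measure ℝ) : Prop where
  le : ∀ k, F k ≤ mΩ
  mono : Monotone F
  measurable_R : ∀ k, Measurable[F (k + 1)] (R k)
  measurable_J : ∀ k, Measurable[F (k + 1)] (J k)
  indep_R : ∀ k, Indep (MeasurableSpace.comap (R k) inferInstance)
    (F k ⊔ MeasurableSpace.comap (J k) inferInstance) P
  indep_J : ∀ k, Indep (MeasurableSpace.comap (J k) inferInstance) (F k) P
  uniform : ∀ k j, P.real (J k ⁻¹' {j}) = (d : ℝ)⁻¹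
  law : ∀ k, P.map (R k) = μ

/-- The `j`-th coordinate of the walk at time `k`. -/
def walkCoord {Ω : Type*} {d : ℕ} (J : ℕ → Ω → Fin d) (R : ℕ → Ω → ℝ) (k : ℕ) (j : Fin d)
    (ω : Ω) : ℝ :=
  ∑ i ∈ Finset.range k, R i ω * (if J i ω = j then 1 else 0)

/-- The coordinate of the walk at time `k` in the direction of the next step. -/
def walkNext {Ω : Type*} {d : ℕ} (J : ℕ → Ω → Fin d) (R : ℕ → Ω → ℝ) (k : ℕ) (ω : Ω) : ℝ :=
  walkCoord J R k (J k ω) ω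

lemma walkCoord_succ {Ω : Type*} {d : ℕ} (J : ℕ → Ω → Fin d) (R : ℕ → Ω → ℝ) (k : ℕ) (j : Fin d)
    (ω : Ω) : walkCoord J R (k + 1) j ω =
      walkCoord J R k j ω + R k ω * (if J k ω = j then 1 else 0) := by
  simp [walkCoord, Finset.sum_range_succ]

/-- Averaging the next coordinate over the uniform direction produces this total divided by `d`; it
is the linear term in the conditional variance of an increment. -/
lemma sum_walkCoord {Ω : Type*} {d : ℕ} (J : ℕ → Ω → Fin d) (R : ℕ → Ω → ℝ) (k : ℕ) (ω : Ω) :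
    ∑ j, walkCoord J R k j ω = ∑ i ∈ Finset.range k, R i ω := by
  simp only [walkCoord]
  rw [Finset.sum_comm]
  simp

/-- The square of the norm splits into a sum of squares and a double sum over collisions. -/
lemma sum_walkCoord_sq {Ω : Type*} {d : ℕ} (J : ℕ → Ω → Fin d) (R : ℕ → Ω → ℝ) (n : ℕ) (ω : Ω) :
    ∑ j, walkCoord J R n j ω ^ 2 =
      ∑ i ∈ Finset.range n, R i ω ^ 2 + 2 * ∑ i ∈ Finset.range n, R i ω * walkNext J R i ω := by
  induction n with
  | zero => simp [walkCoord]
  | succ k ih =>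
    have h : ∀ j, walkCoord J R (k + 1) j ω ^ 2 = walkCoord J R k j ω ^ 2 +
        (if J k ω = j then 2 * (R k ω * walkCoord J R k j ω) + R k ω ^ 2 else 0) := by
      intro j
      rw [walkCoord_succ]
      split_ifs <;> ring
    simp only [h, Finset.sum_add_distrib, ih, Finset.sum_range_succ, Finset.sum_ite_eq,
      Finset.mem_univ, if_true, walkNext]
    ring

lemma walkCoord_sub {Ω : Type*} {d : ℕ} (J : ℕ → Ω → Fin d) (R R' : ℕ → Ω → ℝ) (k : ℕ) (j : Fin d)
    (ω : Ω) : walkCoord J (fun i ω => R i ω - R' i ω) k j ω =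
      walkCoord J R k j ω - walkCoord J R' k j ω := by
  simp only [walkCoord, ← Finset.sum_sub_distrib, sub_mul]

lemma abs_walkCoord_le {Ω : Type*} {d : ℕ} (J : ℕ → Ω → Fin d) {R : ℕ → Ω → ℝ} {B : ℝ}
    (hB : ∀ i ω, |R i ω| ≤ B) (k : ℕ) (j : Fin d) (ω : Ω) : |walkCoord J R k j ω| ≤ k * B := by
  refine (Finset.abs_sum_le_sum_abs _ _).trans ?_
  calc _ ≤ ∑ i ∈ Finset.range k, B := by
        refine Finset.sum_le_sum fun i _ => ?_
        have := hB i ω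
        split_ifs
        · simpa using this
        · simpa using (abs_nonneg _).trans this
    _ = k * B := by simp

/-! ### Integrating out the noise; orthogonality of martingale increments -/

namespace IsAxisNoise

variable {Ω : Type*} [mΩ : MeasurableSpace Ω] {P : Measure Ω} {d : ℕ}
  {F : ℕ → MeasurableSpace Ω} {J : ℕ → Ω → Fin d} {R : ℕ → Ω → ℝ} {μ : Measure ℝ}

/-- Transformed step lengths drive a walk with the same directions and the same past. This lets
every estimate be applied to the truncated walk, coupled with the original one. -/
lemma comp (h : IsAxisNoise P F J R μ) {g : ℝ → ℝ} (hg : Measurable g) :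
    IsAxisNoise P F J (fun k ω => g (R k ω)) (μ.map g) where
  le := h.le
  mono := h.mono
  measurable_R k := hg.comp (h.measurable_R k)
  measurable_J := h.measurable_J
  indep_R k := by
    refine indep_of_indep_of_le_left (h.indep_R k) ?_
    rintro _ ⟨s, hs, rfl⟩
    exact ⟨g ⁻¹' s, hg hs, rfl⟩
  indep_J := h.indep_J
  uniform := h.uniform
  law k := by
    rw [← h.law k, Measure.map_map hg ((h.measurable_R k).mono (h.le _) le_rfl)]
    rfl

lemma measurable_R' (h : IsAxisNoise P F J R μ) (k : ℕ) : Measurable (R k) :=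
  (h.measurable_R k).mono (h.le _) le_rfl

lemma measurable_J' (h : IsAxisNoise P F J R μ) (k : ℕ) : Measurable (J k) :=
  (h.measurable_J k).mono (h.le _) le_rfl

lemma sup_le (h : IsAxisNoise P F J R μ) (k : ℕ) :
    F k ⊔ MeasurableSpace.comap (J k) inferInstance ≤ mΩ :=
  _root_.sup_le (h.le k) (h.measurable_J' k).comap_le

lemma sup_le_succ (h : IsAxisNoise P F J R μ) (k : ℕ) :
    F k ⊔ MeasurableSpace.comap (J k) inferInstance ≤ F (k + 1) :=
  _root_.sup_le (h.mono k.le_succ) (h.measurable_J k).comap_le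

lemma isProbabilityMeasure [IsProbabilityMeasure P] (h : IsAxisNoise P F J R μ) : IsProbabilityMeasure μ := by
  rw [← h.law 0]
  exact Measure.isProbabilityMeasure_map (h.measurable_R' 0).aemeasurable

lemma integral_law (h : IsAxisNoise P F J R μ) {E : Type*} [NormedAddCommGroup E]
    [NormedSpace ℝ E] {g : ℝ → E} (hg : StronglyMeasurable g) (k : ℕ) :
    ∫ ω, g (R k ω) ∂P = ∫ x, g x ∂μ := by
  rw [← h.law k, integral_map (h.measurable_R' k).aemeasurable hg.aestronglyMeasurable]

lemma memLp_law (h : IsAxisNoise P F J R μ) {g : ℝ → ℝ} {p : ENNReal} (hg : MemLp g p μ) (k : ℕ) :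
    MemLp (fun ω => g (R k ω)) p P := by
  rw [← h.law k] at hg
  exact hg.comp_of_map (h.measurable_R' k).aemeasurable

section mul

variable {𝕜 : Type*} [RCLike 𝕜]

lemma indepFun (h : IsAxisNoise P F J R μ) {g : ℝ → 𝕜} (hg : Measurable g) {k : ℕ}
    {X : Ω → 𝕜} (hX : Measurable[F k ⊔ MeasurableSpace.comap (J k) inferInstance] X) :
    IndepFun (fun ω => g (R k ω)) X P := by
  refine indep_of_indep_of_le_left (indep_of_indep_of_le_right (h.indep_R k) hX.comap_le) ?_
  rintro _ ⟨s, hs, rfl⟩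
  exact ⟨g ⁻¹' s, hg hs, rfl⟩

/-- `R k` can be integrated out of products with variables of the past and `J k`. -/
lemma integral_mul (h : IsAxisNoise P F J R μ) {g : ℝ → 𝕜} (hg : Measurable g) {k : ℕ}
    {X : Ω → 𝕜} (hX : Measurable[F k ⊔ MeasurableSpace.comap (J k) inferInstance] X) :
    ∫ ω, g (R k ω) * X ω ∂P = (∫ x, g x ∂μ) * ∫ ω, X ω ∂P := by
  rw [(h.indepFun hg hX).integral_fun_mul_eq_mul_integral
    (hg.comp (h.measurable_R' k)).aestronglyMeasurable
    (hX.mono (h.sup_le k) le_rfl).aestronglyMeasurable,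
    h.integral_law hg.stronglyMeasurable]

/-- `J k` can be integrated out. -/
lemma integral_eval (h : IsAxisNoise P F J R μ) {k : ℕ} {H : Fin d → Ω → 𝕜}
    (hH : ∀ j, Measurable[F k] (H j)) (hi : ∀ j, Integrable (H j) P) :
    ∫ ω, H (J k ω) ω ∂P = (d : 𝕜)⁻¹ * ∑ j, ∫ ω, H j ω ∂P := by
  have hms (j : Fin d) : MeasurableSet (J k ⁻¹' {j}) := h.measurable_J' k (measurableSet_singleton j)
  have e : ∀ ω, H (J k ω) ω = ∑ j, (J k ⁻¹' {j}).indicator (fun _ => (1 : 𝕜)) ω * H j ω := by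
    intro ω
    rw [Finset.sum_eq_single (J k ω)]
    · simp
    · intro j _ hj
      simp [Set.indicator, Ne.symm hj]
    · simp
  simp only [e]
  rw [integral_finsetSum, Finset.mul_sum]
  · refine Finset.sum_congr rfl fun j _ => ?_
    have hind : IndepFun ((J k ⁻¹' {j}).indicator (fun _ => (1 : 𝕜))) (H j) P := by
      refine indep_of_indep_of_le_left
        (indep_of_indep_of_le_right (h.indep_J k) (hH j).comap_le) ?_
      refine Measurable.comap_le ?_
      exact (measurable_const.indicator ⟨{j}, measurableSet_singleton j, rfl⟩)
    rw [hind.integral_fun_mul_eq_mul_integral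
      (measurable_const.indicator (hms j)).aestronglyMeasurable (hi j).1,
      integral_indicator_const _ (hms j), h.uniform]
    simp [RCLike.real_smul_eq_coe_mul]
  · intro j _
    exact (hi j).bdd_mul (c := 1) (measurable_const.indicator (hms j)).aestronglyMeasurable
      (ae_of_all _ fun ω => by by_cases hω : J k ω = j <;> simp [Set.indicator, hω])

end mul

lemma measurable_walkCoord (h : IsAxisNoise P F J R μ) (k : ℕ) (j : Fin d) :
    Measurable[F k] (walkCoord J R k j) := by
  unfold walkCoord
  refine Finset.measurable_fun_sum _ fun i hi => ?_
  have hle : F (i + 1) ≤ F k := h.mono (Finset.mem_range.1 hi)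
  refine ((h.measurable_R i).mono hle le_rfl).mul ?_
  refine Measurable.ite ?_ measurable_const measurable_const
  exact (h.measurable_J i).mono hle le_rfl (measurableSet_singleton j)

lemma measurable_walkNext (h : IsAxisNoise P F J R μ) (k : ℕ) :
    Measurable[F k ⊔ MeasurableSpace.comap (J k) inferInstance] (walkNext J R k) := by
  have e : walkNext J R k = fun ω => ∑ j, (if J k ω = j then walkCoord J R k j ω else 0) := by
    ext ω
    simp [walkNext]
  rw [e]
  refine Finset.measurable_fun_sum _ fun j _ => ?_
  refine Measurable.ite ?_ ((h.measurable_walkCoord k j).mono le_sup_left le_rfl) measurable_const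
  exact (comap_measurable (J k)).mono le_sup_right le_rfl (measurableSet_singleton j)

/-- Orthogonality of martingale increments of product form. -/
lemma integral_sum_mul_sq (h : IsAxisNoise P F J R μ) {g : ℝ → ℝ} (hg : Measurable g)
    (hg2 : MemLp g 2 μ) (hg0 : ∫ x, g x ∂μ = 0) {X : ℕ → Ω → ℝ}
    (hX : ∀ k, Measurable[F k ⊔ MeasurableSpace.comap (J k) inferInstance] (X k))
    (hX2 : ∀ k, MemLp (X k) 2 P) (n : ℕ) :
    MemLp (fun ω => ∑ k ∈ Finset.range n, g (R k ω) * X k ω) 2 P ∧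
    ∫ ω, (∑ k ∈ Finset.range n, g (R k ω) * X k ω) ^ 2 ∂P =
      (∫ x, g x ^ 2 ∂μ) * ∑ k ∈ Finset.range n, ∫ ω, X k ω ^ 2 ∂P := by
  have hD : ∀ k, MemLp (fun ω => g (R k ω) * X k ω) 2 P := by
    intro k
    rw [memLp_two_iff_integrable_sq]
    · simp only [mul_pow]
      exact (h.indepFun (hg.pow_const 2) ((hX k).pow_const 2)).integrable_mul
        (h.memLp_law hg2 k).integrable_sq (hX2 k).integrable_sq
    · exact ((hg.comp (h.measurable_R' k)).mul
        ((hX k).mono (h.sup_le k) le_rfl)).aestronglyMeasurable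
  induction n with
  | zero => simp
  | succ n ih =>
    obtain ⟨ih1, ih2⟩ := ih
    refine ⟨by simp only [Finset.sum_range_succ]; exact ih1.add (hD n), ?_⟩
    have hM : Measurable[F n] (fun ω => ∑ k ∈ Finset.range n, g (R k ω) * X k ω) := by
      refine Finset.measurable_fun_sum _ fun i hi => ?_
      have hle : F (i + 1) ≤ F n := h.mono (Finset.mem_range.1 hi)
      exact (hg.comp ((h.measurable_R i).mono hle le_rfl)).mul
        ((hX i).mono ((h.sup_le_succ i).trans hle) le_rfl)
    -- The cross term is `g (R n)` times a variable measurable with respect to the past and `J n`,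
    -- so the mean zero of `g` removes it.
    have hcross := h.integral_mul hg (X := fun ω => X n ω *
      ∑ k ∈ Finset.range n, g (R k ω) * X k ω) (k := n) ((hX n).mul (hM.mono le_sup_left le_rfl))
    have hsq := h.integral_mul (hg.pow_const 2) ((hX n).pow_const 2)
    rw [hg0, zero_mul] at hcross
    have hint := (hD n).integrable_mul ih1
    have e : ∀ ω, (∑ k ∈ Finset.range (n + 1), g (R k ω) * X k ω) ^ 2 =
        (∑ k ∈ Finset.range n, g (R k ω) * X k ω) ^ 2 +
        2 * (g (R n ω) * (X n ω * ∑ k ∈ Finset.range n, g (R k ω) * X k ω)) +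
        g (R n ω) ^ 2 * X n ω ^ 2 := by
      intro ω
      rw [Finset.sum_range_succ]
      ring
    simp only [e]
    rw [integral_add, integral_add, ih2, integral_const_mul, hcross, hsq, Finset.sum_range_succ]
    · ring
    · exact ih1.integrable_sq
    · refine Integrable.const_mul ?_ 2
      refine hint.congr (ae_of_all _ fun ω => ?_)
      simp only [Pi.mul_apply]
      ring
    · refine ih1.integrable_sq.add (Integrable.const_mul ?_ 2)
      refine hint.congr (ae_of_all _ fun ω => ?_)
      simp only [Pi.mul_apply]
      ring
    · simpa only [mul_pow] using (hD n).integrable_sq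

end IsAxisNoise

/-! ### Second moments of the coordinates and of the collision sum -/

namespace IsAxisNoise

variable {Ω : Type*} [mΩ : MeasurableSpace Ω] {P : Measure Ω} [IsProbabilityMeasure P] {d : ℕ}
  {F : ℕ → MeasurableSpace Ω} {J : ℕ → Ω → Fin d} {R : ℕ → Ω → ℝ} {μ : Measure ℝ}

lemma measurable_indicator (_h : IsAxisNoise P F J R μ) (k : ℕ) (j : Fin d) :
    Measurable[F k ⊔ MeasurableSpace.comap (J k) inferInstance]
      (fun ω => if J k ω = j then (1 : ℝ) else 0) := by
  refine Measurable.ite ?_ measurable_const measurable_const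
  exact (comap_measurable (J k)).mono le_sup_right le_rfl (measurableSet_singleton j)

lemma integral_indicator (h : IsAxisNoise P F J R μ) (k : ℕ) (j : Fin d) :
    ∫ ω, (if J k ω = j then (1 : ℝ) else 0) ∂P = (d : ℝ)⁻¹ := by
  have := integral_indicator_const (μ := P) (1 : ℝ)
    (h.measurable_J' k (measurableSet_singleton j))
  rw [h.uniform] at this
  simpa [Set.indicator] using this

lemma memLp_indicator (h : IsAxisNoise P F J R μ) (k : ℕ) (j : Fin d) (p : ENNReal) :
    MemLp (fun ω => if J k ω = j then (1 : ℝ) else 0) p P :=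
  MemLp.of_bound ((h.measurable_indicator k j).mono (h.sup_le k) le_rfl).aestronglyMeasurable 1
    (ae_of_all _ fun ω => by split_ifs <;> simp)

/-- A coordinate is a martingale whose `i`-th step is multiplied by the indicator of `J i = j`, and
this indicator has second moment `1 / d`; orthogonality adds up `k` such terms. -/
lemma walkCoord_sq (h : IsAxisNoise P F J R μ) (h2 : MemLp id 2 μ) (h0 : ∫ x, x ∂μ = 0)
    (k : ℕ) (j : Fin d) : MemLp (walkCoord J R k j) 2 P ∧
      ∫ ω, walkCoord J R k j ω ^ 2 ∂P = (∫ x, x ^ 2 ∂μ) * (k / d) := by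
  have := h.integral_sum_mul_sq measurable_id h2 h0 (fun k => h.measurable_indicator k j)
    (fun k => h.memLp_indicator k j 2) k
  refine ⟨this.1, ?_⟩
  have e : ∀ ω, walkCoord J R k j ω = ∑ i ∈ Finset.range k,
    id (R i ω) * (if J i ω = j then (1 : ℝ) else 0) := fun ω => rfl
  simp only [e]
  rw [this.2]
  simp [ite_pow, h.integral_indicator, div_eq_mul_inv]

lemma memLp_walkNext (h : IsAxisNoise P F J R μ) {p : ENNReal} {k : ℕ}
    (hp : ∀ j, MemLp (walkCoord J R k j) p P) : MemLp (walkNext J R k) p P := by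
  have e : walkNext J R k =
      fun ω => ∑ j, (J k ⁻¹' {j}).indicator (walkCoord J R k j) ω := by
    ext ω
    simp [walkNext, Set.indicator]
  rw [e]
  exact memLp_finsetSum _ fun j _ =>
    (hp j).indicator (h.measurable_J' k (measurableSet_singleton j))

lemma measurable_walkCoord' (h : IsAxisNoise P F J R μ) (k : ℕ) (j : Fin d) :
    Measurable (walkCoord J R k j) :=
  (h.measurable_walkCoord k j).mono (h.le k) le_rfl

lemma measurable_walkNext' (h : IsAxisNoise P F J R μ) (k : ℕ) : Measurable (walkNext J R k) :=
  (h.measurable_walkNext k).mono (h.sup_le k) le_rfl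

lemma walkNext_sq (h : IsAxisNoise P F J R μ) (h2 : MemLp id 2 μ) (h0 : ∫ x, x ∂μ = 0)
    (k : ℕ) : MemLp (walkNext J R k) 2 P ∧
      ∫ ω, walkNext J R k ω ^ 2 ∂P = (∫ x, x ^ 2 ∂μ) * (k / d) := by
  refine ⟨h.memLp_walkNext fun j => (h.walkCoord_sq h2 h0 k j).1, ?_⟩
  have := h.integral_eval (k := k) (H := fun j ω => walkCoord J R k j ω ^ 2)
    (fun j => (h.measurable_walkCoord k j).pow_const 2)
    (fun j => (h.walkCoord_sq h2 h0 k j).1.integrable_sq)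
  simp only [walkNext]
  rw [this]
  simp only [fun j => (h.walkCoord_sq h2 h0 k j).2, Finset.sum_const, Finset.card_univ,
    Fintype.card_fin, nsmul_eq_mul]
  rcases Nat.eq_zero_or_pos d with rfl | hd
  · simp
  · field_simp

lemma sum_range_cast_le (n : ℕ) : ∑ k ∈ Finset.range n, (k : ℝ) ≤ (n : ℝ) ^ 2 / 2 := by
  induction n with
  | zero => simp
  | succ n ih =>
    rw [Finset.sum_range_succ]
    push_cast
    nlinarith

/-- The second moment of a decoupled double sum over collisions. -/
lemma integral_sum_mul_walkNext_sq_le (h : IsAxisNoise P F J R μ) {g f : ℝ → ℝ}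
    (hg : Measurable g) (hg2 : MemLp g 2 μ) (hg0 : ∫ x, g x ∂μ = 0)
    (hf : Measurable f) (hf2 : MemLp f 2 μ) (hf0 : ∫ x, f x ∂μ = 0) (n : ℕ) :
    MemLp (fun ω => ∑ k ∈ Finset.range n, g (R k ω) *
      walkNext J (fun k ω => f (R k ω)) k ω) 2 P ∧
    ∫ ω, (∑ k ∈ Finset.range n, g (R k ω) * walkNext J (fun k ω => f (R k ω)) k ω) ^ 2 ∂P ≤
      (∫ x, g x ^ 2 ∂μ) * (∫ x, f x ^ 2 ∂μ) * (n ^ 2 / (2 * d)) := by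
  have hcomp := h.comp hf
  have hid : MemLp id 2 (μ.map f) := by
    rw [memLp_map_measure_iff aestronglyMeasurable_id hf.aemeasurable]
    exact hf2
  have hz : ∫ x, x ∂(μ.map f) = 0 := by
    rw [integral_map hf.aemeasurable (f := fun x => x) aestronglyMeasurable_id]
    exact hf0
  -- The later step carries `g` and the earlier steps carry `f`. Different functions are allowed
  -- because truncation error appears in one factor at a time.
  have := h.integral_sum_mul_sq hg hg2 hg0 hcomp.measurable_walkNext
    (fun k => (hcomp.walkNext_sq hid hz k).1) n
  refine ⟨this.1, ?_⟩
  rw [this.2]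
  simp only [fun k => (hcomp.walkNext_sq hid hz k).2]
  rw [integral_map hf.aemeasurable (by fun_prop), ← Finset.mul_sum, ← Finset.sum_div, mul_assoc]
  have h1 : 0 ≤ ∫ x, g x ^ 2 ∂μ := integral_nonneg fun x => sq_nonneg _
  have h2 : 0 ≤ ∫ x, f x ^ 2 ∂μ := integral_nonneg fun x => sq_nonneg _
  have h3 := sum_range_cast_le n
  rw [← div_div]
  gcongr

lemma integral_sum_sq (h : IsAxisNoise P F J R μ) {g : ℝ → ℝ} (hg : Measurable g)
    (hg2 : MemLp g 2 μ) (hg0 : ∫ x, g x ∂μ = 0) (n : ℕ) :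
    MemLp (fun ω => ∑ k ∈ Finset.range n, g (R k ω)) 2 P ∧
    ∫ ω, (∑ k ∈ Finset.range n, g (R k ω)) ^ 2 ∂P = n * ∫ x, g x ^ 2 ∂μ := by
  have := h.integral_sum_mul_sq hg hg2 hg0 (X := fun _ _ => 1) (fun k => measurable_const)
    (fun k => memLp_const 1) n
  simp only [mul_one] at this
  refine ⟨this.1, this.2.trans ?_⟩
  simp [mul_comm]

section bounded

variable {B : ℝ}

lemma ae_abs_le (h : IsAxisNoise P F J R μ) (hB : ∀ i ω, |R i ω| ≤ B) : ∀ᵐ x ∂μ, |x| ≤ B := by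
  rw [← h.law 0, ae_map_iff (h.measurable_R' 0).aemeasurable]
  · exact ae_of_all _ (hB 0)
  · exact measurableSet_le measurable_norm measurable_const

lemma integrable_of_bounded (h : IsAxisNoise P F J R μ) (hB : ∀ i ω, |R i ω| ≤ B) {g : ℝ → ℝ}
    (hg : Continuous g) (p : ENNReal) : MemLp g p μ := by
  have := h.isProbabilityMeasure
  obtain ⟨C, hC⟩ := (isCompact_Icc (a := -B) (b := B)).exists_bound_of_continuousOn hg.continuousOn
  refine MemLp.of_bound hg.aestronglyMeasurable C ?_
  filter_upwards [h.ae_abs_le hB] with x hx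
  exact hC x (abs_le.1 hx)

/-- Concentration of the squared norm of the walk. -/
lemma integral_sum_walkCoord_sq_sub_sq_le (h : IsAxisNoise P F J R μ) (hB : ∀ i ω, |R i ω| ≤ B)
    (h0 : ∫ x, x ∂μ = 0) (n : ℕ) :
    MemLp (fun ω => ∑ j, walkCoord J R n j ω ^ 2 - n * ∫ x, x ^ 2 ∂μ) 2 P ∧
    ∫ ω, (∑ j, walkCoord J R n j ω ^ 2 - n * ∫ x, x ^ 2 ∂μ) ^ 2 ∂P ≤
      2 * n * ∫ x, (x ^ 2 - ∫ y, y ^ 2 ∂μ) ^ 2 ∂μ + 4 * (∫ x, x ^ 2 ∂μ) ^ 2 * (n ^ 2 / d) := by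
  have := h.isProbabilityMeasure
  set s := ∫ x, x ^ 2 ∂μ with hs
  have h1 := h.integral_sum_sq (g := fun x => x ^ 2 - s) (by fun_prop)
    (h.integrable_of_bounded hB (by fun_prop) 2) (by
      rw [integral_sub ((h.integrable_of_bounded hB (by fun_prop) 1).integrable le_rfl)
        (integrable_const _)]
      simp [hs]) n
  have h2 := h.integral_sum_mul_walkNext_sq_le measurable_id
    (h.integrable_of_bounded hB (by fun_prop) 2) h0 measurable_id
    (h.integrable_of_bounded hB (by fun_prop) 2) h0 n
  simp only [id] at h2
  -- Concentration comes from the decomposition of the squared norm itself: the two centred parts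
  -- have second moments of order `n` and `n² / d`.
  have e : ∀ ω, ∑ j, walkCoord J R n j ω ^ 2 - n * s = ∑ k ∈ Finset.range n, (R k ω ^ 2 - s) +
      2 * ∑ k ∈ Finset.range n, R k ω * walkNext J R k ω := by
    intro ω
    rw [sum_walkCoord_sq, Finset.sum_sub_distrib]
    simp
    ring
  simp only [e]
  refine ⟨h1.1.add (h2.1.const_mul 2), ?_⟩
  calc _ ≤ ∫ ω, (2 * (∑ k ∈ Finset.range n, (R k ω ^ 2 - s)) ^ 2 +
        8 * (∑ k ∈ Finset.range n, R k ω * walkNext J R k ω) ^ 2) ∂P := by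
        refine integral_mono (h1.1.add (h2.1.const_mul 2)).integrable_sq
          ((h1.1.integrable_sq.const_mul 2).add (h2.1.integrable_sq.const_mul 8)) fun ω => ?_
        simp only
        nlinarith [sq_nonneg (∑ k ∈ Finset.range n, (R k ω ^ 2 - s) -
          2 * ∑ k ∈ Finset.range n, R k ω * walkNext J R k ω)]
    _ ≤ _ := by
        rw [integral_add (h1.1.integrable_sq.const_mul 2) (h2.1.integrable_sq.const_mul 8),
          integral_const_mul, integral_const_mul, h1.2]
        have := h2.2
        rw [← hs] at this
        have e2 : s * s * ((n : ℝ) ^ 2 / (2 * d)) = s ^ 2 * (n ^ 2 / d) / 2 := by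
          rw [mul_comm (2 : ℝ), ← div_div]
          ring
        rw [e2] at this
        linarith

end bounded

end IsAxisNoise

/-! ### Fourth moments for bounded steps -/

namespace IsAxisNoise

variable {Ω : Type*} [mΩ : MeasurableSpace Ω] {P : Measure Ω} [IsProbabilityMeasure P] {d : ℕ}
  {F : ℕ → MeasurableSpace Ω} {J : ℕ → Ω → Fin d} {R : ℕ → Ω → ℝ} {μ : Measure ℝ} {B : ℝ}

lemma integrable_walkCoord_pow (h : IsAxisNoise P F J R μ) (hB : ∀ i ω, |R i ω| ≤ B) (k : ℕ)
    (j : Fin d) (m : ℕ) : Integrable (fun ω => walkCoord J R k j ω ^ m) P := by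
  refine Integrable.of_bound ((h.measurable_walkCoord' k j).pow_const m).aestronglyMeasurable
    ((k * B) ^ m) (ae_of_all _ fun ω => ?_)
  rw [norm_pow]
  exact pow_le_pow_left₀ (norm_nonneg _) (abs_walkCoord_le J hB k j ω) m

lemma integrable_walkNext_pow (h : IsAxisNoise P F J R μ) (hB : ∀ i ω, |R i ω| ≤ B) (k : ℕ)
    (m : ℕ) : Integrable (fun ω => walkNext J R k ω ^ m) P := by
  refine Integrable.of_bound ((h.measurable_walkNext' k).pow_const m).aestronglyMeasurable
    ((k * B) ^ m) (ae_of_all _ fun ω => ?_)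
  rw [norm_pow]
  exact pow_le_pow_left₀ (norm_nonneg _) (abs_walkCoord_le J hB k _ ω) m

lemma integral_sq_le (h : IsAxisNoise P F J R μ) (hB : ∀ i ω, |R i ω| ≤ B) :
    ∫ x, x ^ 2 ∂μ ≤ B ^ 2 := by
  have := h.isProbabilityMeasure
  calc _ ≤ ∫ _, B ^ 2 ∂μ := by
        refine integral_mono_ae
          ((h.integrable_of_bounded hB (by fun_prop) 1).integrable le_rfl) (integrable_const _) ?_
        filter_upwards [h.ae_abs_le hB] with x hx
        exact sq_le_sq' (abs_le.1 hx).1 (abs_le.1 hx).2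
    _ = _ := by simp

/-- Induction on time: in the expansion of `(p + r)^4` the term cubic in the old coordinate has mean
zero, the quadratic one contributes order `k / d²`, and the quartic one order `1 / d`. Summation
over time gives `(k / d)² + k / d`. -/
lemma integral_walkCoord_pow_four_le (h : IsAxisNoise P F J R μ) (hB : ∀ i ω, |R i ω| ≤ B)
    (h0 : ∫ x, x ∂μ = 0) (k : ℕ) (j : Fin d) :
    ∫ ω, walkCoord J R k j ω ^ 4 ∂P ≤ 8 * B ^ 4 * ((k / d) ^ 2 + k / d) := by
  have hμ := h.isProbabilityMeasure
  have hL2 := h.integrable_of_bounded hB continuous_id 2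
  induction k with
  | zero => simp [walkCoord]
  | succ k ih =>
    have e : ∀ ω, walkCoord J R (k + 1) j ω ^ 4 ≤ walkCoord J R k j ω ^ 4 +
        4 * (R k ω * ((if J k ω = j then 1 else 0) * walkCoord J R k j ω ^ 3)) +
        8 * B ^ 2 * ((if J k ω = j then 1 else 0) * walkCoord J R k j ω ^ 2) +
        3 * B ^ 4 * (if J k ω = j then 1 else 0) := by
      intro ω
      rw [walkCoord_succ]
      have hb : R k ω ^ 2 ≤ B ^ 2 := sq_le_sq' (abs_le.1 (hB k ω)).1 (abs_le.1 (hB k ω)).2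
      have hb4 : R k ω ^ 4 ≤ B ^ 4 := by
        calc R k ω ^ 4 = (R k ω ^ 2) ^ 2 := by ring
          _ ≤ (B ^ 2) ^ 2 := by gcongr
          _ = B ^ 4 := by ring
      split_ifs
      · generalize walkCoord J R k j ω = p at *
        -- The odd term is absorbed by `4 p r³ ≤ 2 p² r² + 2 r⁴`, which turns the coefficients 6 and
        -- 1 of `p² r²` and `r⁴` into 8 and 3.
        nlinarith [sq_nonneg (p * R k ω - R k ω ^ 2), mul_nonneg (sub_nonneg.2 hb) (sq_nonneg p)]
      · simp
    have hm1 := (h.measurable_indicator k j).mono (h.sup_le k) le_rfl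
    have hi (m : ℕ) : Integrable (fun ω => (if J k ω = j then (1 : ℝ) else 0) *
        walkCoord J R k j ω ^ m) P :=
      (h.integrable_walkCoord_pow hB k j m).bdd_mul (c := 1) hm1.aestronglyMeasurable
        (ae_of_all _ fun ω => by split_ifs <;> simp)
    have hi' : Integrable (fun ω => R k ω * ((if J k ω = j then (1 : ℝ) else 0) *
        walkCoord J R k j ω ^ 3)) P :=
      (hi 3).bdd_mul (c := B) (h.measurable_R' k).aestronglyMeasurable (ae_of_all _ fun ω => hB k ω)
    have hi0 := (h.memLp_indicator k j 1).integrable le_rfl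
    have h1 : ∫ ω, R k ω * ((if J k ω = j then (1 : ℝ) else 0) * walkCoord J R k j ω ^ 3) ∂P = 0 := by
      have := h.integral_mul measurable_id (k := k) ((h.measurable_indicator k j).mul
        (((h.measurable_walkCoord k j).mono le_sup_left le_rfl).pow_const 3))
      simpa [h0] using this
    have h2 : ∫ ω, (if J k ω = j then (1 : ℝ) else 0) * walkCoord J R k j ω ^ 2 ∂P =
        (∫ x, x ^ 2 ∂μ) * (k / d) * (d : ℝ)⁻¹ := by
      have hind : IndepFun (fun ω => (if J k ω = j then (1 : ℝ) else 0))
          (fun ω => walkCoord J R k j ω ^ 2) P := by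
        refine indep_of_indep_of_le_left (indep_of_indep_of_le_right (h.indep_J k)
          ((h.measurable_walkCoord k j).pow_const 2).comap_le) (Measurable.comap_le ?_)
        refine Measurable.ite ?_ measurable_const measurable_const
        exact comap_measurable (J k) (measurableSet_singleton j)
      rw [hind.integral_fun_mul_eq_mul_integral hm1.aestronglyMeasurable
        (h.integrable_walkCoord_pow hB k j 2).1, h.integral_indicator,
        (h.walkCoord_sq hL2 h0 k j).2]
      ring
    calc _ ≤ ∫ ω, (walkCoord J R k j ω ^ 4 +
        4 * (R k ω * ((if J k ω = j then 1 else 0) * walkCoord J R k j ω ^ 3)) +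
        8 * B ^ 2 * ((if J k ω = j then 1 else 0) * walkCoord J R k j ω ^ 2) +
        3 * B ^ 4 * (if J k ω = j then 1 else 0)) ∂P :=
          integral_mono (h.integrable_walkCoord_pow hB _ j 4)
            ((((h.integrable_walkCoord_pow hB k j 4).add (hi'.const_mul 4)).add
              ((hi 2).const_mul _)).add (hi0.const_mul _)) e
      _ = ∫ ω, walkCoord J R k j ω ^ 4 ∂P +
          8 * B ^ 2 * ((∫ x, x ^ 2 ∂μ) * (k / d) * (d : ℝ)⁻¹) + 3 * B ^ 4 * (d : ℝ)⁻¹ := by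
        have i1 := h.integrable_walkCoord_pow hB k j 4
        have i2 := hi'.const_mul 4
        have i3 := (hi 2).const_mul (8 * B ^ 2)
        have i4 := hi0.const_mul (3 * B ^ 4)
        rw [integral_add ?_ i4, integral_add ?_ i3, integral_add i1 i2,
          integral_const_mul, integral_const_mul, integral_const_mul, h1, h2, h.integral_indicator]
        · ring
        · exact i1.add i2
        · exact (i1.add i2).add i3
      _ ≤ 8 * B ^ 4 * ((k / d) ^ 2 + k / d) +
          8 * B ^ 2 * (B ^ 2 * (k / d) * (d : ℝ)⁻¹) + 3 * B ^ 4 * (d : ℝ)⁻¹ := by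
        gcongr
        exact h.integral_sq_le hB
      _ ≤ _ := by
        push_cast
        have hd : (0 : ℝ) ≤ (d : ℝ)⁻¹ := by positivity
        simp only [div_eq_mul_inv]
        have hB4 : 0 ≤ B ^ 4 := by positivity
        have hk : (0 : ℝ) ≤ k := by positivity
        nlinarith [mul_nonneg hB4 hd, mul_nonneg (mul_nonneg hB4 hk) (mul_nonneg hd hd),
          mul_nonneg hB4 (mul_nonneg hd hd)]

lemma integral_walkNext_pow_four_le (h : IsAxisNoise P F J R μ) (hB : ∀ i ω, |R i ω| ≤ B)
    (h0 : ∫ x, x ∂μ = 0) (k : ℕ) :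
    ∫ ω, walkNext J R k ω ^ 4 ∂P ≤ 8 * B ^ 4 * ((k / d) ^ 2 + k / d) := by
  have := h.integral_eval (k := k) (H := fun j ω => walkCoord J R k j ω ^ 4)
    (fun j => (h.measurable_walkCoord k j).pow_const 4)
    (fun j => h.integrable_walkCoord_pow hB k j 4)
  simp only [walkNext]
  rw [this]
  calc _ ≤ (d : ℝ)⁻¹ * ∑ j : Fin d, 8 * B ^ 4 * (((k : ℝ) / d) ^ 2 + k / d) := by
        gcongr with j
        exact h.integral_walkCoord_pow_four_le hB h0 k j
    _ ≤ _ := by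
      rw [Finset.sum_const, Finset.card_univ, Fintype.card_fin, nsmul_eq_mul]
      rcases Nat.eq_zero_or_pos d with rfl | hd
      · simp
      · field_simp
        rfl

end IsAxisNoise

/-! ### Elementary bounds for exponentials -/

/-- Third order Taylor bound for the complex exponential, with the remainder split into
second and fourth powers. -/
lemma norm_exp_I_sub_taylor_le {η : ℝ} (hη : 0 < η) (x : ℝ) :
    ‖Complex.exp (x * Complex.I) - (1 + x * Complex.I - x ^ 2 / 2)‖ ≤
      2 * (η * x ^ 2 + x ^ 4 / η) := by
  -- Weighted arithmetic-geometric mean. Trading the cubic remainder for second and fourth powers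
  -- means that no third absolute moment has to be estimated.
  have h3 : |x| ^ 3 ≤ (η * x ^ 2 + x ^ 4 / η) / 2 := by
    have h : 0 ≤ η⁻¹ * (x ^ 2 * (|x| - η) ^ 2) := by positivity
    have e : η⁻¹ * (x ^ 2 * (|x| - η) ^ 2) = η * x ^ 2 + x ^ 4 / η - 2 * |x| ^ 3 := by
      rw [← sq_abs x, show x ^ 4 = |x| ^ 4 by rw [show (4 : ℕ) = 2 * 2 by rfl, pow_mul, pow_mul, sq_abs]]
      field_simp
      ring
    linarith
  suffices ‖Complex.exp (x * Complex.I) - (1 + x * Complex.I - x ^ 2 / 2)‖ ≤ 4 * |x| ^ 3 by linarith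
  rcases le_total |x| 1 with hx | hx
  · have := Complex.exp_bound (x := x * Complex.I) (by simpa using hx) (n := 3) (by norm_num)
    have e : ∑ m ∈ Finset.range 3, ((x : ℂ) * Complex.I) ^ m / (m.factorial : ℂ) =
        1 + x * Complex.I - x ^ 2 / 2 := by
      simp [Finset.sum_range_succ, mul_pow, Nat.factorial]
      ring
    rw [e] at this
    refine this.trans ?_
    simp only [norm_mul, Complex.norm_real, Complex.norm_I, mul_one, Real.norm_eq_abs]
    rw [mul_comm]
    gcongr
    norm_num [Nat.factorial]
  · calc _ ≤ ‖Complex.exp (x * Complex.I)‖ + (‖(1 : ℂ)‖ + ‖x * Complex.I‖ + ‖(x : ℂ) ^ 2 / 2‖) := by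
          refine (norm_sub_le _ _).trans ?_
          gcongr
          refine (norm_sub_le _ _).trans ?_
          gcongr
          exact norm_add_le _ _
      _ = 1 + (1 + |x| + |x| ^ 2 / 2) := by
          simp [Complex.norm_exp_ofReal_mul_I]
      _ ≤ _ := by nlinarith [sq_nonneg |x|, mul_nonneg (sub_nonneg.2 hx) (sq_nonneg |x|)]

lemma abs_exp_neg_sub_le {x : ℝ} (hx : 0 ≤ x) : |Real.exp (-x) - (1 - x)| ≤ x ^ 2 / 2 := by
  rw [abs_le]
  refine ⟨by nlinarith [Real.add_one_le_exp (-x)], ?_⟩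
  have h1 := Real.quadratic_le_exp_of_nonneg hx
  have h2 : Real.exp (-x) * Real.exp x = 1 := by rw [← Real.exp_add]; simp
  have h3 := Real.exp_pos (-x)
  have h4 : Real.exp (-x) * (1 + x + x ^ 2 / 2) ≤ 1 := by
    refine le_trans ?_ h2.le
    gcongr
  -- Since `1 + x + x² / 2 ≤ exp x`, it is enough that the product with `1 - x + x² / 2` is at least
  -- 1.
  have h5 : (1 + x + x ^ 2 / 2) * (1 - x + x ^ 2 / 2) = 1 + x ^ 4 / 4 := by ring
  have h6 : 0 < 1 + x + x ^ 2 / 2 := by positivity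
  have h7 : 1 ≤ (1 + x + x ^ 2 / 2) * (1 - x + x ^ 2 / 2) := by rw [h5]; nlinarith [sq_nonneg (x ^ 2)]
  nlinarith [mul_comm (Real.exp (-x)) (1 + x + x ^ 2 / 2)]

lemma integral_abs_le_sqrt {Ω : Type*} [MeasurableSpace Ω] {P : Measure Ω} [IsProbabilityMeasure P]
    {X : Ω → ℝ} (hX : MemLp X 2 P) : ∫ ω, |X ω| ∂P ≤ √(∫ ω, X ω ^ 2 ∂P) := by
  refine Real.le_sqrt_of_sq_le ?_
  have h := variance_nonneg |X| P
  rw [variance_eq_sub hX.abs] at h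
  simp only [Pi.pow_apply, Pi.abs_apply, sq_abs] at h
  linarith

/-! ### Moments of an increment, tested against the past -/

namespace IsAxisNoise

variable {Ω : Type*} [mΩ : MeasurableSpace Ω] {P : Measure Ω} [IsProbabilityMeasure P] {d : ℕ}
  {F : ℕ → MeasurableSpace Ω} {J : ℕ → Ω → Fin d} {R : ℕ → Ω → ℝ} {μ : Measure ℝ} {B : ℝ}

/-- The increment at time `k` of the combination with weights `a` and `b` of the centered sum of
squares and the double sum over collisions. -/
def increment (J : ℕ → Ω → Fin d) (R : ℕ → Ω → ℝ) (s a b : ℝ) (k : ℕ) (ω : Ω) : ℝ :=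
  a * (R k ω ^ 2 - s) + 2 * b * (R k ω * walkNext J R k ω)

lemma measurable_increment (h : IsAxisNoise P F J R μ) (s a b : ℝ) (k : ℕ) :
    Measurable[F (k + 1)] (increment J R s a b k) :=
  ((((h.measurable_R k).pow_const 2).sub_const s).const_mul a).add
    (((h.measurable_R k).mul ((h.measurable_walkNext k).mono (h.sup_le_succ k) le_rfl)).const_mul _)

section step

variable (h : IsAxisNoise P F J R μ) (hB : ∀ i ω, |R i ω| ≤ B) (h0 : ∫ x, x ∂μ = 0) {k : ℕ}
  {Z : Ω → ℂ} (hZ : Measurable[F k] Z) (hZ1 : ∀ ω, ‖Z ω‖ ≤ 1)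

include h hB hZ hZ1

/-- Substitute for conditioning on the past: `Z` is an arbitrary test variable bounded by 1. First
`R k` is integrated out, then the uniform direction `J k`, which replaces the next coordinate by an
average over all coordinates. -/
lemma integral_mul_walkNext_pow {g : ℝ → ℝ} (hg : Continuous g) (m : ℕ) :
    Integrable (fun ω => Z ω * ((g (R k ω) * walkNext J R k ω ^ m : ℝ) : ℂ)) P ∧
    ∫ ω, Z ω * ((g (R k ω) * walkNext J R k ω ^ m : ℝ) : ℂ) ∂P =
      ((∫ x, g x ∂μ : ℝ) : ℂ) * ((d : ℂ)⁻¹ *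
        ∑ j, ∫ ω, Z ω * ((walkCoord J R k j ω ^ m : ℝ) : ℂ) ∂P) := by
  have hZm := hZ.mono (h.le k) le_rfl
  have hi1 : Integrable (fun ω => g (R k ω) * walkNext J R k ω ^ m) P := by
    obtain ⟨C, hC⟩ := (isCompact_Icc (a := -B) (b := B)).exists_bound_of_continuousOn
      hg.continuousOn
    exact (h.integrable_walkNext_pow hB k m).bdd_mul (c := C)
      (hg.measurable.comp (h.measurable_R' k)).aestronglyMeasurable
      (ae_of_all _ fun ω => hC _ (abs_le.1 (hB k ω)))
  refine ⟨hi1.ofReal.bdd_mul (c := 1) hZm.aestronglyMeasurable (ae_of_all _ hZ1), ?_⟩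
  have h1 := h.integral_mul (𝕜 := ℂ) (g := fun x => (g x : ℂ)) (k := k)
    (X := fun ω => Z ω * ((walkNext J R k ω ^ m : ℝ) : ℂ))
    (Complex.measurable_ofReal.comp hg.measurable)
    ((hZ.mono le_sup_left le_rfl).mul
      (Complex.measurable_ofReal.comp ((h.measurable_walkNext k).pow_const m)))
  have h2 := h.integral_eval (𝕜 := ℂ) (k := k)
    (H := fun j ω => Z ω * ((walkCoord J R k j ω ^ m : ℝ) : ℂ))
    (fun j => hZ.mul (Complex.measurable_ofReal.comp ((h.measurable_walkCoord k j).pow_const m)))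
    (fun j => (h.integrable_walkCoord_pow hB k j m).ofReal.bdd_mul (c := 1)
      hZm.aestronglyMeasurable (ae_of_all _ hZ1))
  rw [← h2, ← integral_complex_ofReal]
  refine Eq.trans ?_ h1
  refine integral_congr_ae (ae_of_all _ fun ω => ?_)
  push_cast
  ring

include h0

lemma integral_mul_increment (a b : ℝ) :
    Integrable (fun ω => Z ω * (increment J R (∫ x, x ^ 2 ∂μ) a b k ω : ℂ)) P ∧
    ∫ ω, Z ω * (increment J R (∫ x, x ^ 2 ∂μ) a b k ω : ℂ) ∂P = 0 := by
  have := h.isProbabilityMeasure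
  obtain ⟨i0, e0⟩ := h.integral_mul_walkNext_pow hB hZ hZ1
    (g := fun x => a * (x ^ 2 - ∫ x, x ^ 2 ∂μ)) (by fun_prop) 0
  obtain ⟨i1, e1⟩ := h.integral_mul_walkNext_pow hB hZ hZ1
    (g := fun x => 2 * b * x) (by fun_prop) 1
  have z0 : ∫ x, a * (x ^ 2 - ∫ x, x ^ 2 ∂μ) ∂μ = 0 := by
    rw [integral_const_mul, integral_sub
      ((h.integrable_of_bounded hB (by fun_prop) 1).integrable le_rfl) (integrable_const _)]
    simp
  have z1 : ∫ x, 2 * b * x ∂μ = 0 := by rw [integral_const_mul, h0, mul_zero]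
  have e : (fun ω => Z ω * (increment J R (∫ x, x ^ 2 ∂μ) a b k ω : ℂ)) = fun ω =>
      Z ω * ((a * (R k ω ^ 2 - ∫ x, x ^ 2 ∂μ) * walkNext J R k ω ^ 0 : ℝ) : ℂ) +
      Z ω * ((2 * b * R k ω * walkNext J R k ω ^ 1 : ℝ) : ℂ) := by
    ext ω
    rw [← mul_add, ← Complex.ofReal_add]
    congr 2
    simp only [increment]
    ring
  rw [e]
  refine ⟨i0.add i1, ?_⟩
  rw [integral_add i0 i1, e0, e1, z0, z1]
  simp

/-- Expanding the square gives powers 0, 1 and 2 of the next coordinate. Averaged over the direction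
they become a constant, the sum of the past steps over `d`, and the squared norm over `d`; together
these form the conditional variance. -/
lemma integral_mul_increment_sq (a b : ℝ) :
    Integrable (fun ω => Z ω * ((increment J R (∫ x, x ^ 2 ∂μ) a b k ω ^ 2 : ℝ) : ℂ)) P ∧
    ∫ ω, Z ω * ((increment J R (∫ x, x ^ 2 ∂μ) a b k ω ^ 2 : ℝ) : ℂ) ∂P =
      ((a ^ 2 * ∫ x, (x ^ 2 - ∫ y, y ^ 2 ∂μ) ^ 2 ∂μ : ℝ) : ℂ) * ∫ ω, Z ω ∂P +
      ((4 * (a * b) * ∫ x, x * (x ^ 2 - ∫ y, y ^ 2 ∂μ) ∂μ : ℝ) : ℂ) *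
        ((d : ℂ)⁻¹ * ∫ ω, Z ω * ((∑ i ∈ Finset.range k, R i ω : ℝ) : ℂ) ∂P) +
      ((4 * b ^ 2 * ∫ x, x ^ 2 ∂μ : ℝ) : ℂ) *
        ((d : ℂ)⁻¹ * ∫ ω, Z ω * ((∑ j, walkCoord J R k j ω ^ 2 : ℝ) : ℂ) ∂P) := by
  have := h.isProbabilityMeasure
  have hZm := hZ.mono (h.le k) le_rfl
  set s := ∫ x, x ^ 2 ∂μ
  obtain ⟨i1, e1⟩ := h.integral_mul_walkNext_pow hB hZ hZ1
    (g := fun x => 4 * (a * b) * (x * (x ^ 2 - s))) (by fun_prop) 1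
  obtain ⟨i2, e2⟩ := h.integral_mul_walkNext_pow hB hZ hZ1
    (g := fun x => 4 * b ^ 2 * x ^ 2) (by fun_prop) 2
  have h3 := h.integral_mul (𝕜 := ℂ) (g := fun x => ((a ^ 2 * (x ^ 2 - s) ^ 2 : ℝ) : ℂ)) (k := k)
    (by fun_prop) (hZ.mono le_sup_left le_rfl)
  have i3 : Integrable (fun ω => ((a ^ 2 * (R k ω ^ 2 - s) ^ 2 : ℝ) : ℂ) * Z ω) P := by
    refine Integrable.mul_bdd (c := 1) ?_ hZm.aestronglyMeasurable (ae_of_all _ hZ1)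
    exact ((h.memLp_law (h.integrable_of_bounded hB (g := fun x => a ^ 2 * (x ^ 2 - s) ^ 2)
      (by fun_prop) 1) k).integrable le_rfl).ofReal (𝕜 := ℂ)
  have e : (fun ω => Z ω * ((increment J R s a b k ω ^ 2 : ℝ) : ℂ)) = fun ω =>
      ((a ^ 2 * (R k ω ^ 2 - s) ^ 2 : ℝ) : ℂ) * Z ω +
      Z ω * ((4 * (a * b) * (R k ω * (R k ω ^ 2 - s)) * walkNext J R k ω ^ 1 : ℝ) : ℂ) +
      Z ω * ((4 * b ^ 2 * R k ω ^ 2 * walkNext J R k ω ^ 2 : ℝ) : ℂ) := by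
    ext ω
    simp only [increment]
    push_cast
    ring
  have hsum (m : ℕ) : ∑ j, ∫ ω, Z ω * ((walkCoord J R k j ω ^ m : ℝ) : ℂ) ∂P =
      ∫ ω, Z ω * ((∑ j, walkCoord J R k j ω ^ m : ℝ) : ℂ) ∂P := by
    rw [← integral_finsetSum]
    · refine integral_congr_ae (ae_of_all _ fun ω => ?_)
      simp only [Complex.ofReal_sum, Finset.mul_sum]
    · intro j _
      exact (h.integrable_walkCoord_pow hB k j m).ofReal.bdd_mul (c := 1)
        hZm.aestronglyMeasurable (ae_of_all _ hZ1)
  rw [e]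
  refine ⟨(i3.add i1).add i2, ?_⟩
  rw [integral_add ?_ i2, integral_add i3 i1, e1, e2, h3, hsum, hsum, integral_complex_ofReal,
    integral_const_mul, integral_const_mul, integral_const_mul]
  · simp only [pow_one, sum_walkCoord]
    rfl
  · exact i3.add i1

end step

/-- The deterministic approximation of the conditional variance of the increment. -/
def incrementVar (μ : Measure ℝ) (d : ℕ) (a b : ℝ) (k : ℕ) : ℝ :=
  a ^ 2 * ∫ x, (x ^ 2 - ∫ y, y ^ 2 ∂μ) ^ 2 ∂μ + 4 * b ^ 2 * (∫ x, x ^ 2 ∂μ) ^ 2 * (k / d)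

lemma abs_sq_sub_le (h : IsAxisNoise P F J R μ) (hB : ∀ i ω, |R i ω| ≤ B) {x : ℝ}
    (hx : |x| ≤ B) : |x ^ 2 - ∫ y, y ^ 2 ∂μ| ≤ B ^ 2 := by
  have h1 := h.integral_sq_le hB
  have h2 : 0 ≤ ∫ y, y ^ 2 ∂μ := integral_nonneg fun x => sq_nonneg _
  have h3 : x ^ 2 ≤ B ^ 2 := sq_le_sq' (abs_le.1 hx).1 (abs_le.1 hx).2
  rw [abs_le]
  constructor <;> nlinarith [sq_nonneg x]

lemma integral_sq_sub_sq_le (h : IsAxisNoise P F J R μ) (hB : ∀ i ω, |R i ω| ≤ B) :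
    ∫ x, (x ^ 2 - ∫ y, y ^ 2 ∂μ) ^ 2 ∂μ ≤ B ^ 4 := by
  have := h.isProbabilityMeasure
  calc _ ≤ ∫ _, B ^ 4 ∂μ := by
        refine integral_mono_ae
          ((h.integrable_of_bounded hB (by fun_prop) 1).integrable le_rfl) (integrable_const _) ?_
        filter_upwards [h.ae_abs_le hB] with x hx
        rw [← sq_abs, show B ^ 4 = (B ^ 2) ^ 2 by ring]
        exact pow_le_pow_left₀ (abs_nonneg _) (h.abs_sq_sub_le hB hx) 2
    _ = _ := by simp

lemma integral_increment_sq_le (h : IsAxisNoise P F J R μ) (hB : ∀ i ω, |R i ω| ≤ B)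
    (h0 : ∫ x, x ∂μ = 0) (a b : ℝ) (k : ℕ) :
    ∫ ω, increment J R (∫ x, x ^ 2 ∂μ) a b k ω ^ 2 ∂P ≤ 2 * incrementVar μ d a b k := by
  have hp := h.isProbabilityMeasure
  set s := ∫ x, x ^ 2 ∂μ with hs
  have i1 : Integrable (fun ω => (R k ω ^ 2 - s) ^ 2) P := (h.memLp_law
    (h.integrable_of_bounded hB (g := fun x => (x ^ 2 - s) ^ 2) (by fun_prop) 1) k).integrable le_rfl
  have i2 : Integrable (fun ω => R k ω ^ 2 * walkNext J R k ω ^ 2) P :=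
    (h.integrable_walkNext_pow hB k 2).bdd_mul (c := B ^ 2)
      ((h.measurable_R' k).pow_const 2).aestronglyMeasurable (ae_of_all _ fun ω => by
        rw [norm_pow]; exact pow_le_pow_left₀ (norm_nonneg _) (hB k ω) 2)
  have e2 := h.integral_mul (g := fun x : ℝ => x ^ 2) (by fun_prop) ((h.measurable_walkNext k).pow_const 2)
  have e1 := h.integral_law (g := fun x => (x ^ 2 - s) ^ 2)
    (Continuous.stronglyMeasurable (by fun_prop)) k
  calc _ ≤ ∫ ω, (2 * a ^ 2 * (R k ω ^ 2 - s) ^ 2 +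
        8 * b ^ 2 * (R k ω ^ 2 * walkNext J R k ω ^ 2)) ∂P := by
        refine integral_mono_of_nonneg (ae_of_all _ fun ω => sq_nonneg _)
          ((i1.const_mul _).add (i2.const_mul _)) (ae_of_all _ fun ω => ?_)
        simp only [increment]
        nlinarith [sq_nonneg (a * (R k ω ^ 2 - s) - 2 * b * (R k ω * walkNext J R k ω))]
    _ = _ := by
        rw [integral_add (i1.const_mul _) (i2.const_mul _), integral_const_mul,
          integral_const_mul, e1, e2,
          (h.walkNext_sq (h.integrable_of_bounded hB continuous_id 2) h0 k).2, incrementVar,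
          ← hs]
        ring

lemma integral_increment_pow_four_le (h : IsAxisNoise P F J R μ) (hB : ∀ i ω, |R i ω| ≤ B)
    (h0 : ∫ x, x ∂μ = 0) (a b : ℝ) (k : ℕ) :
    Integrable (fun ω => increment J R (∫ x, x ^ 2 ∂μ) a b k ω ^ 4) P ∧
    ∫ ω, increment J R (∫ x, x ^ 2 ∂μ) a b k ω ^ 4 ∂P ≤
      B ^ 8 * (8 * a ^ 4 + 1024 * b ^ 4 * ((k / d) ^ 2 + k / d)) := by
  have hp := h.isProbabilityMeasure
  set s := ∫ x, x ^ 2 ∂μ with hs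
  have i2 := h.integrable_walkNext_pow hB k 4
  have i : Integrable (fun ω => 8 * a ^ 4 * B ^ 8 + 128 * b ^ 4 * B ^ 4 * walkNext J R k ω ^ 4) P :=
    (integrable_const _).add (i2.const_mul _)
  have hle : ∀ ω, increment J R s a b k ω ^ 4 ≤
      8 * a ^ 4 * B ^ 8 + 128 * b ^ 4 * B ^ 4 * walkNext J R k ω ^ 4 := by
    intro ω
    have h1 : (R k ω ^ 2 - s) ^ 4 ≤ B ^ 8 := by
      rw [← (show Even 4 by decide).pow_abs, show B ^ 8 = (B ^ 2) ^ 4 by ring]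
      exact pow_le_pow_left₀ (abs_nonneg _) (h.abs_sq_sub_le hB (hB k ω)) 4
    have h2 : R k ω ^ 4 ≤ B ^ 4 := by
      rw [← (show Even 4 by decide).pow_abs]
      exact pow_le_pow_left₀ (abs_nonneg _) (hB k ω) 4
    -- This gives the constant `128 = 8 · 2⁴`; the later `1024 = 128 · 8` includes the fourth moment
    -- bound for the next coordinate.
    have h3 : ∀ x y : ℝ, (x + y) ^ 4 ≤ 8 * x ^ 4 + 8 * y ^ 4 := by
      intro x y
      nlinarith [sq_nonneg (x ^ 2 - y ^ 2), sq_nonneg (x - y), sq_nonneg (x + y),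
        mul_nonneg (sq_nonneg (x - y)) (sq_nonneg (x + y)), mul_nonneg (sq_nonneg (x - y)) (sq_nonneg x), mul_nonneg (sq_nonneg (x - y)) (sq_nonneg y), sq_nonneg ((x-y)^2)]
    calc _ ≤ 8 * (a * (R k ω ^ 2 - s)) ^ 4 + 8 * (2 * b * (R k ω * walkNext J R k ω)) ^ 4 := h3 _ _
      _ = 8 * a ^ 4 * (R k ω ^ 2 - s) ^ 4 + 128 * b ^ 4 * R k ω ^ 4 * walkNext J R k ω ^ 4 := by
        ring
      _ ≤ _ := by gcongr
  refine ⟨i.mono' (((h.measurable_increment s a b k).mono (h.le _) le_rfl).pow_const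
    4).aestronglyMeasurable (ae_of_all _ fun ω => ?_), ?_⟩
  · rw [norm_pow, Real.norm_eq_abs, (show Even 4 by decide).pow_abs]
    exact hle ω
  calc _ ≤ ∫ ω, (8 * a ^ 4 * B ^ 8 + 128 * b ^ 4 * B ^ 4 * walkNext J R k ω ^ 4) ∂P :=
        integral_mono_of_nonneg (ae_of_all _ fun ω => by positivity) i (ae_of_all _ hle)
    _ = 8 * a ^ 4 * B ^ 8 + 128 * b ^ 4 * B ^ 4 * ∫ ω, walkNext J R k ω ^ 4 ∂P := by
        rw [integral_add (integrable_const _) (i2.const_mul _)]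
        simp [integral_const_mul]
    _ ≤ 8 * a ^ 4 * B ^ 8 + 128 * b ^ 4 * B ^ 4 * (8 * B ^ 4 * ((k / d) ^ 2 + k / d)) := by
        gcongr
        exact h.integral_walkNext_pow_four_le hB h0 k
    _ = _ := by ring

end IsAxisNoise

/-! ### Comparison with the normal characteristic function -/

namespace IsAxisNoise

variable {Ω : Type*} [mΩ : MeasurableSpace Ω] {P : Measure Ω} [IsProbabilityMeasure P] {d : ℕ}
  {F : ℕ → MeasurableSpace Ω} {J : ℕ → Ω → Fin d} {R : ℕ → Ω → ℝ} {μ : Measure ℝ} {B : ℝ}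

/-- The error per step in the comparison of the characteristic function of the walk with that of
a normal law. -/
def stepError (B a b : ℝ) (n d : ℕ) (η t : ℝ) : ℝ :=
  4 * η * t ^ 2 * (B ^ 4 * (a ^ 2 + 4 * b ^ 2 * (n / d))) +
  2 * t ^ 4 * (B ^ 8 * (8 * a ^ 4 + 1024 * b ^ 4 * ((n / d) ^ 2 + n / d))) / η +
  2 * t ^ 2 * (|a * b| * B ^ 4 * (√n / d) + b ^ 2 * B ^ 4 * (√(2 * n + 4 * (n ^ 2 / d)) / d)) +
  t ^ 4 * (B ^ 4 * (a ^ 2 + 4 * b ^ 2 * (n / d))) ^ 2 / 8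

lemma incrementVar_nonneg (μ : Measure ℝ) (d : ℕ) (a b : ℝ) (k : ℕ) :
    0 ≤ incrementVar μ d a b k := by
  unfold incrementVar
  have : 0 ≤ ∫ x, (x ^ 2 - ∫ y, y ^ 2 ∂μ) ^ 2 ∂μ := integral_nonneg fun x => sq_nonneg _
  positivity

lemma incrementVar_le (h : IsAxisNoise P F J R μ) (hB : ∀ i ω, |R i ω| ≤ B) (a b : ℝ)
    {k n : ℕ} (hk : k ≤ n) :
    incrementVar μ d a b k ≤ B ^ 4 * (a ^ 2 + 4 * b ^ 2 * (n / d)) := by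
  unfold incrementVar
  have h1 := h.integral_sq_sub_sq_le hB
  have h2 := h.integral_sq_le hB
  have h3 : 0 ≤ ∫ x, x ^ 2 ∂μ := integral_nonneg fun x => sq_nonneg _
  calc _ ≤ a ^ 2 * B ^ 4 + 4 * b ^ 2 * (B ^ 2) ^ 2 * ((n : ℝ) / d) := by gcongr
    _ = _ := by ring

lemma norm_integral_mul_le {Z : Ω → ℂ} (hZ1 : ∀ ω, ‖Z ω‖ ≤ 1) {X : Ω → ℝ} (hX : MemLp X 2 P) :
    ‖∫ ω, Z ω * (X ω : ℂ) ∂P‖ ≤ √(∫ ω, X ω ^ 2 ∂P) := by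
  refine le_trans ?_ (integral_abs_le_sqrt hX)
  refine norm_integral_le_of_norm_le (hX.integrable one_le_two).abs (ae_of_all _ fun ω => ?_)
  rw [norm_mul, Complex.norm_real]
  exact mul_le_of_le_one_left (abs_nonneg _) (hZ1 ω)

/-- The conditional variance is almost deterministic. Its linear term is controlled by the `L²` norm
of the sum of the steps, at most `√n B`, and its quadratic term by the concentration of the squared
norm; both carry a factor `1 / d`. -/
lemma norm_integral_mul_increment_sq_sub_le (h : IsAxisNoise P F J R μ)
    (hB : ∀ i ω, |R i ω| ≤ B) (h0 : ∫ x, x ∂μ = 0) (hB0 : 0 ≤ B) {k n : ℕ} (hk : k ≤ n) {Z : Ω → ℂ}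
    (hZ : Measurable[F k] Z) (hZ1 : ∀ ω, ‖Z ω‖ ≤ 1) (a b : ℝ) :
    ‖∫ ω, Z ω * ((increment J R (∫ x, x ^ 2 ∂μ) a b k ω ^ 2 : ℝ) : ℂ) ∂P -
        (incrementVar μ d a b k : ℂ) * ∫ ω, Z ω ∂P‖ ≤
      4 * (|a * b| * B ^ 4 * (√n / d) + b ^ 2 * B ^ 4 * (√(2 * n + 4 * (n ^ 2 / d)) / d)) := by
  have hp := h.isProbabilityMeasure
  have hZm := hZ.mono (h.le k) le_rfl
  have iZ : Integrable Z P := Integrable.of_bound hZm.aestronglyMeasurable 1 (ae_of_all _ hZ1)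
  rw [(h.integral_mul_increment_sq hB h0 hZ hZ1 a b).2]
  set s := ∫ x, x ^ 2 ∂μ with hs
  have hs0 : 0 ≤ s := integral_nonneg fun x => sq_nonneg _
  have hsB : s ≤ B ^ 2 := h.integral_sq_le hB
  have hS := h.integral_sum_sq measurable_id (h.integrable_of_bounded hB continuous_id 2) h0 k
  have hQ := h.integral_sum_walkCoord_sq_sub_sq_le hB h0 k
  have n1 := norm_integral_mul_le hZ1 hS.1
  have n2 := norm_integral_mul_le hZ1 hQ.1
  rw [hS.2] at n1
  -- Centring the squared norm: its mean `k s` yields exactly the second term of `incrementVar`, so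
  -- only the fluctuation remains as an error.
  have hQ2 : ∫ ω, Z ω * ((∑ j, walkCoord J R k j ω ^ 2 : ℝ) : ℂ) ∂P =
      ∫ ω, Z ω * ((∑ j, walkCoord J R k j ω ^ 2 - k * s : ℝ) : ℂ) ∂P +
        ((k * s : ℝ) : ℂ) * ∫ ω, Z ω ∂P := by
    rw [← integral_const_mul (((k * s : ℝ)) : ℂ), ← integral_add]
    · refine integral_congr_ae (ae_of_all _ fun ω => ?_)
      push_cast
      ring
    · exact ((hQ.1.integrable one_le_two).ofReal (𝕜 := ℂ)).bdd_mul (c := 1)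
        hZm.aestronglyMeasurable (ae_of_all _ hZ1)
    · exact iZ.const_mul _
  rw [hQ2]
  have m3 : |∫ x, x * (x ^ 2 - s) ∂μ| ≤ B ^ 3 := by
    suffices hle : ∀ᵐ x ∂μ, ‖x * (x ^ 2 - s)‖ ≤ B ^ 3 by
      simpa using norm_integral_le_of_norm_le_const hle
    filter_upwards [h.ae_abs_le hB] with x hx
    rw [Real.norm_eq_abs, abs_mul, pow_succ' B 2]
    exact mul_le_mul hx (h.abs_sq_sub_le hB hx) (abs_nonneg _) hB0
  have n1' : ‖∫ ω, Z ω * ((∑ i ∈ Finset.range k, R i ω : ℝ) : ℂ) ∂P‖ ≤ √n * B := by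
    refine n1.trans ?_
    rw [← Real.sqrt_sq hB0, ← Real.sqrt_mul (Nat.cast_nonneg _)]
    simp only [id]
    gcongr
  have n2' : ‖∫ ω, Z ω * ((∑ j, walkCoord J R k j ω ^ 2 - k * s : ℝ) : ℂ) ∂P‖ ≤
      √(2 * n + 4 * (n ^ 2 / d)) * B ^ 2 := by
    refine (n2.trans (Real.sqrt_le_sqrt hQ.2)).trans ?_
    rw [← Real.sqrt_sq (sq_nonneg B), ← Real.sqrt_mul (by positivity)]
    refine Real.sqrt_le_sqrt ?_
    have := h.integral_sq_sub_sq_le hB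
    calc _ ≤ 2 * (n : ℝ) * B ^ 4 + 4 * (B ^ 2) ^ 2 * ((n : ℝ) ^ 2 / d) := by gcongr
      _ = _ := by ring
  have e : ∀ z w q : ℂ, ((a ^ 2 * ∫ x, (x ^ 2 - s) ^ 2 ∂μ : ℝ) : ℂ) * z +
      ((4 * (a * b) * ∫ x, x * (x ^ 2 - s) ∂μ : ℝ) : ℂ) * ((d : ℂ)⁻¹ * w) +
      ((4 * b ^ 2 * s : ℝ) : ℂ) * ((d : ℂ)⁻¹ * (q + ((k * s : ℝ) : ℂ) * z)) -
      (incrementVar μ d a b k : ℂ) * z =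
      ((4 * (a * b) * ∫ x, x * (x ^ 2 - s) ∂μ : ℝ) : ℂ) * ((d : ℂ)⁻¹ * w) +
      ((4 * b ^ 2 * s : ℝ) : ℂ) * ((d : ℂ)⁻¹ * q) := by
    intro z w q
    rw [incrementVar, ← hs]
    push_cast
    ring
  rw [e]
  refine (norm_add_le _ _).trans ?_
  rw [norm_mul, norm_mul, norm_mul, norm_mul, Complex.norm_real, Complex.norm_real, norm_inv,
    Complex.norm_natCast, Real.norm_eq_abs, Real.norm_eq_abs, abs_mul, abs_mul, abs_mul (4 * b ^ 2),
    abs_of_nonneg hs0, abs_of_nonneg (show (0 : ℝ) ≤ 4 * b ^ 2 by positivity)]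
  calc _ ≤ |4| * |a * b| * B ^ 3 * ((d : ℝ)⁻¹ * (√n * B)) +
        4 * b ^ 2 * B ^ 2 * ((d : ℝ)⁻¹ * (√(2 * n + 4 * (n ^ 2 / d)) * B ^ 2)) := by gcongr
    _ = _ := by
        rw [abs_of_pos (by norm_num : (0 : ℝ) < 4)]
        ring

/-- One step of the comparison with the normal law. -/
lemma norm_integral_mul_exp_sub_le (h : IsAxisNoise P F J R μ)
    (hB : ∀ i ω, |R i ω| ≤ B) (h0 : ∫ x, x ∂μ = 0) (hB0 : 0 ≤ B) {k n : ℕ} (hk : k ≤ n) {Z : Ω → ℂ}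
    (hZ : Measurable[F k] Z) (hZ1 : ∀ ω, ‖Z ω‖ ≤ 1) (a b t : ℝ) {η : ℝ} (hη : 0 < η) :
    ‖∫ ω, Z ω * Complex.exp ((t * increment J R (∫ x, x ^ 2 ∂μ) a b k ω : ℝ) * Complex.I) ∂P -
        (Real.exp (-(t ^ 2 / 2 * incrementVar μ d a b k)) : ℂ) * ∫ ω, Z ω ∂P‖ ≤
      stepError B a b n d η t := by
  have hp := h.isProbabilityMeasure
  have hZm := hZ.mono (h.le k) le_rfl
  have iZ : Integrable Z P := Integrable.of_bound hZm.aestronglyMeasurable 1 (ae_of_all _ hZ1)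
  have nZ : ‖∫ ω, Z ω ∂P‖ ≤ 1 := by
    refine (norm_integral_le_of_norm_le (integrable_const (1 : ℝ)) (ae_of_all _ hZ1)).trans
      (by simp)
  have H1 := h.integral_mul_increment hB h0 hZ hZ1 a b
  have H2 := h.integral_mul_increment_sq hB h0 hZ hZ1 a b
  have H3 := h.norm_integral_mul_increment_sq_sub_le hB h0 hB0 hk hZ hZ1 a b
  have E2 := h.integral_increment_sq_le hB h0 a b k
  have E4 := h.integral_increment_pow_four_le hB h0 a b k
  have hv := h.incrementVar_le hB a b hk
  have hv0 := incrementVar_nonneg μ d a b k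
  have I2 : Integrable (fun ω => increment J R (∫ x, x ^ 2 ∂μ) a b k ω ^ 2) P := by
    have := (h.integral_mul_increment_sq hB h0 (Z := fun _ => 1) measurable_const
      (fun _ => by simp) a b (k := k)).1.re
    simpa only [one_mul, RCLike.re_to_complex, Complex.ofReal_re] using this
  have mY := (h.measurable_increment (∫ x, x ^ 2 ∂μ) a b k).mono (h.le _) le_rfl
  set Y := increment J R (∫ x, x ^ 2 ∂μ) a b k with hY
  set v := incrementVar μ d a b k
  set w := B ^ 4 * (a ^ 2 + 4 * b ^ 2 * ((n : ℝ) / d)) with hw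
  set c := |a * b| * B ^ 4 * (√n / d) + b ^ 2 * B ^ 4 * (√(2 * n + 4 * (n ^ 2 / d)) / d) with hc
  have iT : Integrable (fun ω => Z ω * (1 + ((t * Y ω : ℝ) : ℂ) * Complex.I -
      ((t * Y ω : ℝ) : ℂ) ^ 2 / 2)) P := by
    have := (iZ.add (H1.1.const_mul (t * Complex.I))).sub (H2.1.const_mul ((t : ℂ) ^ 2 / 2))
    refine this.congr (ae_of_all _ fun ω => ?_)
    simp only [Pi.add_apply, Pi.sub_apply]
    push_cast
    ring
  have eT : ∫ ω, Z ω * (1 + ((t * Y ω : ℝ) : ℂ) * Complex.I -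
      ((t * Y ω : ℝ) : ℂ) ^ 2 / 2) ∂P = ∫ ω, Z ω ∂P -
      (t : ℂ) ^ 2 / 2 * ∫ ω, Z ω * ((Y ω ^ 2 : ℝ) : ℂ) ∂P := by
    have e : (fun ω => Z ω * (1 + ((t * Y ω : ℝ) : ℂ) * Complex.I -
        ((t * Y ω : ℝ) : ℂ) ^ 2 / 2)) = fun ω => Z ω + (t * Complex.I) * (Z ω * (Y ω : ℂ)) -
        (t : ℂ) ^ 2 / 2 * (Z ω * ((Y ω ^ 2 : ℝ) : ℂ)) := by
      ext ω
      push_cast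
      ring
    rw [e, integral_sub ?_ (H2.1.const_mul _), integral_add iZ (H1.1.const_mul _),
      integral_const_mul, integral_const_mul, H1.2]
    · ring
    · exact iZ.add (H1.1.const_mul _)
  have iE : Integrable (fun ω => Z ω * Complex.exp ((t * Y ω : ℝ) * Complex.I)) P := by
    refine iZ.mul_bdd (c := 1) ?_ (ae_of_all _ fun ω => (Complex.norm_exp_ofReal_mul_I _).le)
    exact Measurable.aestronglyMeasurable (by fun_prop)
  have D1 : ‖∫ ω, Z ω * Complex.exp ((t * Y ω : ℝ) * Complex.I) ∂P -
      ∫ ω, Z ω * (1 + ((t * Y ω : ℝ) : ℂ) * Complex.I - ((t * Y ω : ℝ) : ℂ) ^ 2 / 2) ∂P‖ ≤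
      4 * η * t ^ 2 * w +
      2 * t ^ 4 * (B ^ 8 * (8 * a ^ 4 + 1024 * b ^ 4 * (((n : ℝ) / d) ^ 2 + n / d))) / η := by
    rw [← integral_sub iE iT]
    have hb : ‖∫ ω, (Z ω * Complex.exp ((t * Y ω : ℝ) * Complex.I) -
        Z ω * (1 + ((t * Y ω : ℝ) : ℂ) * Complex.I - ((t * Y ω : ℝ) : ℂ) ^ 2 / 2)) ∂P‖ ≤
        ∫ ω, (2 * η * t ^ 2 * Y ω ^ 2 + 2 * t ^ 4 / η * Y ω ^ 4) ∂P := by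
      refine norm_integral_le_of_norm_le ((I2.const_mul _).add (E4.1.const_mul _))
        (ae_of_all _ fun ω => ?_)
      rw [← mul_sub, norm_mul]
      calc _ ≤ 1 * (2 * (η * (t * Y ω) ^ 2 + (t * Y ω) ^ 4 / η)) :=
            mul_le_mul (hZ1 ω) (norm_exp_I_sub_taylor_le hη _) (norm_nonneg _) zero_le_one
        _ = _ := by ring
    refine hb.trans ?_
    rw [integral_add (I2.const_mul _) (E4.1.const_mul _), integral_const_mul, integral_const_mul]
    calc _ ≤ 2 * η * t ^ 2 * (2 * w) + 2 * t ^ 4 / η *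
          (B ^ 8 * (8 * a ^ 4 + 1024 * b ^ 4 * (((n : ℝ) / d) ^ 2 + n / d))) := by
          gcongr
          · exact E2.trans (by gcongr)
          · refine E4.2.trans ?_
            gcongr
      _ = _ := by ring
  have D2 : ‖(t : ℂ) ^ 2 / 2 * (∫ ω, Z ω * ((Y ω ^ 2 : ℝ) : ℂ) ∂P - v * ∫ ω, Z ω ∂P)‖ ≤
      2 * t ^ 2 * c := by
    rw [norm_mul, show ‖(t : ℂ) ^ 2 / 2‖ = t ^ 2 / 2 by simp]
    calc _ ≤ t ^ 2 / 2 * (4 * c) := by gcongr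
      _ = _ := by ring
  have D3 : ‖((Real.exp (-(t ^ 2 / 2 * v)) - (1 - t ^ 2 / 2 * v) : ℝ) : ℂ) * ∫ ω, Z ω ∂P‖ ≤
      t ^ 4 * w ^ 2 / 8 := by
    rw [norm_mul, Complex.norm_real, Real.norm_eq_abs]
    calc _ ≤ (t ^ 2 / 2 * v) ^ 2 / 2 * 1 := by
          gcongr
          exact abs_exp_neg_sub_le (by positivity)
      _ ≤ (t ^ 2 / 2 * w) ^ 2 / 2 * 1 := by gcongr
      _ = _ := by ring
  -- Three errors: the Taylor remainder, which gives the first two summands of `stepError`, the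
  -- conditional variance replaced by `v`, and `exp (-t² v / 2)` linearised. The first order term
  -- vanishes by the martingale property.
  have split : ∫ ω, Z ω * Complex.exp ((t * Y ω : ℝ) * Complex.I) ∂P -
      (Real.exp (-(t ^ 2 / 2 * v)) : ℂ) * ∫ ω, Z ω ∂P =
      (∫ ω, Z ω * Complex.exp ((t * Y ω : ℝ) * Complex.I) ∂P -
      ∫ ω, Z ω * (1 + ((t * Y ω : ℝ) : ℂ) * Complex.I - ((t * Y ω : ℝ) : ℂ) ^ 2 / 2) ∂P) -
      (t : ℂ) ^ 2 / 2 * (∫ ω, Z ω * ((Y ω ^ 2 : ℝ) : ℂ) ∂P - v * ∫ ω, Z ω ∂P) -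
      ((Real.exp (-(t ^ 2 / 2 * v)) - (1 - t ^ 2 / 2 * v) : ℝ) : ℂ) * ∫ ω, Z ω ∂P := by
    rw [eT]
    push_cast
    ring
  rw [split, stepError]
  refine (norm_sub_le _ _).trans (add_le_add ((norm_sub_le _ _).trans (add_le_add D1 D2)) D3)

/-- Comparison of the characteristic function of a weighted combination of the centered sum of
squares and the double sum over collisions with that of a normal law. -/
lemma norm_charFun_sub_le (h : IsAxisNoise P F J R μ)
    (hB : ∀ i ω, |R i ω| ≤ B) (h0 : ∫ x, x ∂μ = 0) (hB0 : 0 ≤ B) {k n : ℕ} (hk : k ≤ n)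
    (a b t : ℝ) {η : ℝ} (hη : 0 < η) :
    ‖∫ ω, Complex.exp ((t * ∑ i ∈ Finset.range k, increment J R (∫ x, x ^ 2 ∂μ) a b i ω : ℝ) *
        Complex.I) ∂P -
      (Real.exp (-(t ^ 2 / 2 * ∑ i ∈ Finset.range k, incrementVar μ d a b i)) : ℂ)‖ ≤
      k * stepError B a b n d η t := by
  induction k with
  | zero => simp
  | succ k ih =>
    set Z : Ω → ℂ := fun ω => Complex.exp ((t * ∑ i ∈ Finset.range k,
      increment J R (∫ x, x ^ 2 ∂μ) a b i ω : ℝ) * Complex.I) with hZdef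
    have hZ : Measurable[F k] Z := by
      refine Complex.measurable_exp.comp (Measurable.mul_const ?_ _)
      refine Complex.measurable_ofReal.comp (Measurable.const_mul ?_ _)
      refine Finset.measurable_fun_sum _ fun i hi => ?_
      exact (h.measurable_increment _ a b i).mono (h.mono (Finset.mem_range.1 hi)) le_rfl
    have hZ1 : ∀ ω, ‖Z ω‖ ≤ 1 := fun ω => (Complex.norm_exp_ofReal_mul_I _).le
    have hs := h.norm_integral_mul_exp_sub_le hB h0 hB0 (k.le_succ.trans hk) hZ hZ1 a b t hη
    have ih' := ih (k.le_succ.trans hk)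
    have e1 : ∀ ω, Complex.exp ((t * ∑ i ∈ Finset.range (k + 1),
        increment J R (∫ x, x ^ 2 ∂μ) a b i ω : ℝ) * Complex.I) =
        Z ω * Complex.exp ((t * increment J R (∫ x, x ^ 2 ∂μ) a b k ω : ℝ) * Complex.I) := by
      intro ω
      rw [hZdef, ← Complex.exp_add, Finset.sum_range_succ]
      push_cast
      ring_nf
    have e2 : Real.exp (-(t ^ 2 / 2 * ∑ i ∈ Finset.range (k + 1), incrementVar μ d a b i)) =
        Real.exp (-(t ^ 2 / 2 * incrementVar μ d a b k)) *
        Real.exp (-(t ^ 2 / 2 * ∑ i ∈ Finset.range k, incrementVar μ d a b i)) := by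
      rw [← Real.exp_add, Finset.sum_range_succ]
      ring_nf
    simp only [e1, e2]
    set q := Real.exp (-(t ^ 2 / 2 * incrementVar μ d a b k)) with hq
    have hq1 : q ≤ 1 := by
      rw [hq, Real.exp_le_one_iff]
      have := incrementVar_nonneg μ d a b k
      have : 0 ≤ t ^ 2 / 2 * incrementVar μ d a b k := by positivity
      linarith
    have hq0 : 0 < q := Real.exp_pos _
    set p := Real.exp (-(t ^ 2 / 2 * ∑ i ∈ Finset.range k, incrementVar μ d a b i))
    -- The factor `q` lies in `(0, 1]`, so the error inherited from the earlier steps is not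
    -- amplified and the one-step errors simply add up.
    have e3 : ∫ ω, Z ω * Complex.exp ((t * increment J R (∫ x, x ^ 2 ∂μ) a b k ω : ℝ) *
        Complex.I) ∂P - ((q * p : ℝ) : ℂ) = (∫ ω, Z ω * Complex.exp ((t * increment J R
        (∫ x, x ^ 2 ∂μ) a b k ω : ℝ) * Complex.I) ∂P - (q : ℂ) * ∫ ω, Z ω ∂P) +
        (q : ℂ) * (∫ ω, Z ω ∂P - (p : ℂ)) := by
      push_cast
      ring
    rw [e3]
    refine (norm_add_le _ _).trans ?_
    rw [norm_mul, Complex.norm_real, Real.norm_eq_abs, abs_of_pos hq0]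
    calc _ ≤ stepError B a b n d η t + 1 * (k * stepError B a b n d η t) := by gcongr
      _ = _ := by push_cast; ring

end IsAxisNoise

/-! ### The limit for bounded steps -/

namespace IsAxisNoise

/-- Rewrites the total error in the convergent quantities `n a²` and `b² n² / d`. In every term
without a factor `η` in the numerator a power of `1 / n`, `1 / d` or `b` is left over and forces it
to zero. -/
lemma mul_stepError_eq (B a b : ℝ) {n d : ℕ} (hn : 0 < n) (hd : 0 < d) (η t : ℝ) :
    n * stepError B a b n d η t =
      4 * η * t ^ 2 * B ^ 4 * (n * a ^ 2 + 4 * (b ^ 2 * n ^ 2 / d)) +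
      2 * t ^ 4 * B ^ 8 / η * (8 * ((n * a ^ 2) ^ 2 * (n : ℝ)⁻¹) +
        1024 * ((b ^ 2 * n ^ 2 / d) ^ 2 * (n : ℝ)⁻¹ + b ^ 2 * (b ^ 2 * n ^ 2 / d))) +
      2 * t ^ 2 * B ^ 4 * (√(n * a ^ 2) * √(b ^ 2 * n ^ 2 / d) * √((d : ℝ)⁻¹) +
        b ^ 2 * n ^ 2 / d * √(2 * (n : ℝ)⁻¹ + 4 * (d : ℝ)⁻¹)) +
      t ^ 4 * B ^ 8 / 8 * ((n * a ^ 2 + 4 * (b ^ 2 * n ^ 2 / d)) ^ 2 * (n : ℝ)⁻¹) := by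
  have hn' : (0 : ℝ) < n := Nat.cast_pos.2 hn
  have hd' : (0 : ℝ) < d := Nat.cast_pos.2 hd
  have h1 : √(n * a ^ 2) * √(b ^ 2 * n ^ 2 / d) * √((d : ℝ)⁻¹) = n * (|a * b| * (√n / d)) := by
    rw [← Real.sqrt_mul (by positivity), ← Real.sqrt_mul (by positivity),
      show (n : ℝ) * a ^ 2 * (b ^ 2 * n ^ 2 / d) * (d : ℝ)⁻¹ = (a * b * (n / d)) ^ 2 * n by
        field_simp, Real.sqrt_mul (sq_nonneg _), Real.sqrt_sq_eq_abs, abs_mul,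
      abs_of_pos (div_pos hn' hd')]
    ring
  have h2 : √(2 * n + 4 * ((n : ℝ) ^ 2 / d)) = n * √(2 * (n : ℝ)⁻¹ + 4 * (d : ℝ)⁻¹) := by
    rw [show 2 * (n : ℝ) + 4 * ((n : ℝ) ^ 2 / d) = n ^ 2 * (2 * (n : ℝ)⁻¹ + 4 * (d : ℝ)⁻¹) by
      field_simp, Real.sqrt_mul (sq_nonneg _), Real.sqrt_sq hn'.le]
  rw [h1, stepError, h2]
  field_simp

lemma sum_range_cast (n : ℕ) : ∑ k ∈ Finset.range n, (k : ℝ) = ((n : ℝ) ^ 2 - n) / 2 := by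
  induction n with
  | zero => simp
  | succ n ih =>
    rw [Finset.sum_range_succ, ih]
    push_cast
    ring

lemma sum_incrementVar (μ : Measure ℝ) (d : ℕ) (a b : ℝ) (n : ℕ) :
    ∑ k ∈ Finset.range n, incrementVar μ d a b k =
      n * a ^ 2 * ∫ x, (x ^ 2 - ∫ y, y ^ 2 ∂μ) ^ 2 ∂μ +
      2 * (∫ x, x ^ 2 ∂μ) ^ 2 * (b ^ 2 * n ^ 2 / d * (1 - (n : ℝ)⁻¹)) := by
  simp only [incrementVar, Finset.sum_add_distrib, Finset.sum_const, Finset.card_range,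
    nsmul_eq_mul, ← Finset.mul_sum, ← Finset.sum_div, sum_range_cast]
  rcases Nat.eq_zero_or_pos n with rfl | hn
  · simp
  · field_simp
    ring

variable {n : ℕ → ℕ} {a b : ℕ → ℝ} {A Q : ℝ}

lemma tendsto_mul_stepError (hn : Tendsto n atTop atTop)
    (ha : Tendsto (fun d => n d * a d ^ 2) atTop (𝓝 A))
    (hb : Tendsto (fun d : ℕ => b d ^ 2 * n d ^ 2 / d) atTop (𝓝 Q)) (hb0 : Tendsto b atTop (𝓝 0))
    (B η t : ℝ) :
    Tendsto (fun d => n d * stepError B (a d) (b d) (n d) d η t) atTop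
      (𝓝 (4 * η * t ^ 2 * B ^ 4 * (A + 4 * Q))) := by
  have hni : Tendsto (fun d => (n d : ℝ)⁻¹) atTop (𝓝 0) :=
    tendsto_inv_atTop_zero.comp (tendsto_natCast_atTop_atTop.comp hn)
  have hdi : Tendsto (fun d : ℕ => (d : ℝ)⁻¹) atTop (𝓝 0) :=
    tendsto_inv_atTop_zero.comp tendsto_natCast_atTop_atTop
  have hpq := ha.add (hb.const_mul 4)
  have key := (((hpq.const_mul (4 * η * t ^ 2 * B ^ 4)).add
    (((((ha.pow 2).mul hni).const_mul 8).add ((((hb.pow 2).mul hni).add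
      ((hb0.pow 2).mul hb)).const_mul 1024)).const_mul (2 * t ^ 4 * B ^ 8 / η))).add
    (((((ha.sqrt).mul hb.sqrt).mul hdi.sqrt).add (hb.mul
      ((hni.const_mul 2).add (hdi.const_mul 4)).sqrt)).const_mul (2 * t ^ 2 * B ^ 4))).add
    (((hpq.pow 2).mul hni).const_mul (t ^ 4 * B ^ 8 / 8))
  refine Tendsto.congr' ?_ (key.trans (le_of_eq ?_))
  · filter_upwards [hn.eventually_gt_atTop 0, eventually_gt_atTop 0] with d h1 h2
    rw [mul_stepError_eq B (a d) (b d) h1 h2]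
  · simp

lemma tendsto_sum_incrementVar (μ : Measure ℝ) (hn : Tendsto n atTop atTop)
    (ha : Tendsto (fun d => n d * a d ^ 2) atTop (𝓝 A))
    (hb : Tendsto (fun d : ℕ => b d ^ 2 * n d ^ 2 / d) atTop (𝓝 Q)) :
    Tendsto (fun d => ∑ k ∈ Finset.range (n d), incrementVar μ d (a d) (b d) k) atTop
      (𝓝 (A * ∫ x, (x ^ 2 - ∫ y, y ^ 2 ∂μ) ^ 2 ∂μ + 2 * (∫ x, x ^ 2 ∂μ) ^ 2 * Q)) := by
  have hni : Tendsto (fun d => (n d : ℝ)⁻¹) atTop (𝓝 0) :=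
    tendsto_inv_atTop_zero.comp (tendsto_natCast_atTop_atTop.comp hn)
  simp only [sum_incrementVar]
  have := (ha.mul_const (∫ x, (x ^ 2 - ∫ y, y ^ 2 ∂μ) ^ 2 ∂μ)).add
    ((hb.mul (hni.const_sub 1)).const_mul (2 * (∫ x, x ^ 2 ∂μ) ^ 2))
  simpa using this

variable {Ω : Type*} [mΩ : MeasurableSpace Ω] {P : Measure Ω} [IsProbabilityMeasure P]
  {R : ℕ → Ω → ℝ} {μ : Measure ℝ} {B : ℝ}

/-- The limit of the characteristic functions for bounded step lengths. -/
lemma eventually_norm_charFun_sub_lt_of_bounded (hn : Tendsto n atTop atTop)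
    (ha : Tendsto (fun d => n d * a d ^ 2) atTop (𝓝 A))
    (hb : Tendsto (fun d : ℕ => b d ^ 2 * n d ^ 2 / d) atTop (𝓝 Q)) (hb0 : Tendsto b atTop (𝓝 0))
    (hB : ∀ i ω, |R i ω| ≤ B) (hB0 : 0 ≤ B) (h0 : ∫ x, x ∂μ = 0) (t : ℝ) {ε : ℝ} (hε : 0 < ε) :
    ∀ᶠ d : ℕ in atTop, ∀ (F : ℕ → MeasurableSpace Ω) (J : ℕ → Ω → Fin d),
      IsAxisNoise P F J R μ →
      ‖∫ ω, Complex.exp ((t * ∑ i ∈ Finset.range (n d),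
          increment J R (∫ x, x ^ 2 ∂μ) (a d) (b d) i ω : ℝ) * Complex.I) ∂P -
        (Real.exp (-(t ^ 2 / 2 * (A * ∫ x, (x ^ 2 - ∫ y, y ^ 2 ∂μ) ^ 2 ∂μ +
          2 * (∫ x, x ^ 2 ∂μ) ^ 2 * Q))) : ℂ)‖ < ε := by
  have h1 := (((tendsto_sum_incrementVar μ hn ha hb).const_mul (t ^ 2 / 2)).neg).rexp
  -- The only error surviving the limit in `d` is linear in `η`, so `η` is fixed before `d` grows.
  obtain ⟨η, hη, hηε⟩ : ∃ η : ℝ, 0 < η ∧ 4 * η * t ^ 2 * B ^ 4 * (A + 4 * Q) < ε / 2 := by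
    have : Tendsto (fun η : ℝ => 4 * η * t ^ 2 * B ^ 4 * (A + 4 * Q)) (𝓝[>] 0) (𝓝 0) := by
      refine tendsto_nhdsWithin_of_tendsto_nhds ?_
      exact Continuous.tendsto' (by fun_prop) _ _ (by simp)
    exact ((eventually_mem_nhdsWithin.and (this.eventually_lt_const (half_pos hε)))).exists
  filter_upwards [(tendsto_mul_stepError hn ha hb hb0 B η t).eventually_lt_const hηε,
    (Metric.tendsto_nhds.1 h1) (ε / 2) (half_pos hε)] with d hd1 hd2 F J h
  have h3 := h.norm_charFun_sub_le hB h0 hB0 (le_refl (n d)) (a d) (b d) t hη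
  rw [dist_eq_norm, ← Complex.norm_real, Complex.ofReal_sub] at hd2
  calc _ ≤ _ := norm_sub_le_norm_sub_add_norm_sub _ _ _
    _ < ε / 2 + ε / 2 := add_lt_add (h3.trans_lt hd1) hd2
    _ = ε := by ring

end IsAxisNoise

/-! ### Truncation of the step lengths -/

/-- A centered square integrable law is approximated by bounded centered functions. -/
lemma exists_bounded_centered_approx (μ : Measure ℝ) [IsProbabilityMeasure μ]
    (h2 : MemLp id 2 μ) (h0 : ∫ x, x ∂μ = 0) :
    ∃ f : ℕ → ℝ → ℝ, (∀ M, Measurable (f M)) ∧ (∀ M, ∃ B, 0 ≤ B ∧ ∀ x, |f M x| ≤ B) ∧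
      (∀ M, ∫ x, f M x ∂μ = 0) ∧
      Tendsto (fun M => ∫ x, (x - f M x) ^ 2 ∂μ) atTop (𝓝 0) ∧
      Tendsto (fun M => ∫ x, f M x ^ 2 ∂μ) atTop (𝓝 (∫ x, x ^ 2 ∂μ)) ∧
      (MemLp (fun x => x ^ 2) 2 μ →
        Tendsto (fun M => ∫ x, (x ^ 2 - f M x ^ 2) ^ 2 ∂μ) atTop (𝓝 0) ∧
        Tendsto (fun M => ∫ x, f M x ^ 4 ∂μ) atTop (𝓝 (∫ x, x ^ 4 ∂μ))) := by
  have i1 : Integrable (fun x : ℝ => x) μ := h2.integrable one_le_two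
  set g : ℕ → ℝ → ℝ := fun M x => Set.indicator (Set.Icc (-(M : ℝ)) M) id x with hg
  have hgm : ∀ M, Measurable (g M) := fun M => measurable_id.indicator measurableSet_Icc
  have hgx : ∀ M x, |g M x| ≤ |x| := by
    intro M x
    by_cases hx : x ∈ Set.Icc (-(M : ℝ)) M <;> simp [g, hx]
  have hgM : ∀ M x, |g M x| ≤ M := by
    intro M x
    by_cases hx : x ∈ Set.Icc (-(M : ℝ)) M
    · simp only [g, hx, Set.indicator_of_mem, id]
      exact abs_le.2 hx
    · simp [g, hx]
  have hgl : ∀ x, Tendsto (fun M => g M x) atTop (𝓝 x) := by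
    intro x
    refine tendsto_const_nhds.congr' ?_
    filter_upwards [eventually_ge_atTop ⌈|x|⌉₊] with M hM
    have : x ∈ Set.Icc (-(M : ℝ)) M := abs_le.1 (Nat.ceil_le.1 hM)
    simp [g, this]
  have ig : ∀ M, Integrable (g M) μ := fun M => i1.mono (hgm M).aestronglyMeasurable
    (ae_of_all _ (hgx M))
  set m : ℕ → ℝ := fun M => ∫ x, g M x ∂μ with hm
  have hml : Tendsto m atTop (𝓝 0) := by
    rw [← h0]
    exact tendsto_integral_of_dominated_convergence (fun x => |x|)
      (fun M => (hgm M).aestronglyMeasurable) i1.abs (fun M => ae_of_all _ (hgx M))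
      (ae_of_all _ hgl)
  set C := ∫ x, |x| ∂μ with hC
  have hmC : ∀ M, |m M| ≤ C := fun M =>
    norm_integral_le_of_norm_le (f := g M) (g := fun x => |x|) i1.abs (ae_of_all _ (hgx M))
  have hC0 : 0 ≤ C := (abs_nonneg _).trans (hmC 0)
  -- Truncation at `M` destroys the mean zero, so the mean of the truncated variable is subtracted;
  -- it tends to 0 and is bounded by `C`, which keeps the dominating functions independent of `M`.
  set f : ℕ → ℝ → ℝ := fun M x => g M x - m M with hf
  have hfm : ∀ M, Measurable (f M) := fun M => (hgm M).sub_const _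
  have hfx : ∀ M x, |f M x| ≤ |x| + C := fun M x =>
    (abs_sub _ _).trans (add_le_add (hgx M x) (hmC M))
  have hfl : ∀ x, Tendsto (fun M => f M x) atTop (𝓝 x) := by
    intro x
    simpa using (hgl x).sub hml
  have hsq : ∀ M x, f M x ^ 2 ≤ 2 * x ^ 2 + 2 * C ^ 2 := by
    intro M x
    have := pow_le_pow_left₀ (abs_nonneg _) (hfx M x) 2
    rw [sq_abs] at this
    nlinarith [sq_nonneg (|x| - C), sq_abs x]
  have iq : Integrable (fun x : ℝ => x ^ 2) μ := h2.integrable_sq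
  refine ⟨f, hfm, fun M => ⟨M + C, by positivity, fun x =>
    (abs_sub _ _).trans (add_le_add (hgM M x) (hmC M))⟩, fun M => ?_, ?_, ?_, fun h4 => ⟨?_, ?_⟩⟩
  · rw [integral_sub (ig M) (integrable_const _)]
    simp [hm]
  · have := tendsto_integral_of_dominated_convergence (μ := μ) (F := fun M x => (x - f M x) ^ 2)
      (f := fun _ => 0) (fun x => 6 * x ^ 2 + 4 * C ^ 2)
      (fun M => ((measurable_id.sub (hfm M)).pow_const 2).aestronglyMeasurable)
      ((iq.const_mul 6).add (integrable_const _)) (fun M => ae_of_all _ fun x => ?_)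
      (ae_of_all _ fun x => ?_)
    · simpa using this
    · rw [Real.norm_eq_abs, abs_of_nonneg (sq_nonneg _)]
      nlinarith [sq_nonneg (x + f M x), hsq M x]
    · simpa using ((hfl x).const_sub x).pow 2
  · refine tendsto_integral_of_dominated_convergence (fun x => 2 * x ^ 2 + 2 * C ^ 2)
      (fun M => ((hfm M).pow_const 2).aestronglyMeasurable)
      ((iq.const_mul 2).add (integrable_const _)) (fun M => ae_of_all _ fun x => ?_)
      (ae_of_all _ fun x => (hfl x).pow 2)
    rw [Real.norm_eq_abs, abs_of_nonneg (sq_nonneg _)]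
    exact hsq M x
  all_goals
    have iq4 : Integrable (fun x : ℝ => x ^ 4) μ := by
      refine h4.integrable_sq.congr (ae_of_all _ fun x => ?_)
      simp only
      ring
    have hf4 : ∀ M x, f M x ^ 4 ≤ 8 * x ^ 4 + 8 * C ^ 4 := by
      intro M x
      have := pow_le_pow_left₀ (sq_nonneg _) (hsq M x) 2
      nlinarith [sq_nonneg (x ^ 2 - C ^ 2)]
  · have := tendsto_integral_of_dominated_convergence (μ := μ)
      (F := fun M x => (x ^ 2 - f M x ^ 2) ^ 2)
      (f := fun _ => 0) (fun x => 18 * x ^ 4 + 16 * C ^ 4)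
      (fun M => (((measurable_id.pow_const 2).sub ((hfm M).pow_const 2)).pow_const
        2).aestronglyMeasurable)
      ((iq4.const_mul 18).add (integrable_const _)) (fun M => ae_of_all _ fun x => ?_)
      (ae_of_all _ fun x => ?_)
    · simpa using this
    · rw [Real.norm_eq_abs, abs_of_nonneg (sq_nonneg _)]
      nlinarith [sq_nonneg (x ^ 2 + f M x ^ 2), hf4 M x]
    · have h := (((hfl x).pow 2).const_sub (x ^ 2)).pow 2
      rwa [sub_self, zero_pow two_ne_zero] at h
  · refine tendsto_integral_of_dominated_convergence (fun x => 8 * x ^ 4 + 8 * C ^ 4)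
      (fun M => ((hfm M).pow_const 4).aestronglyMeasurable)
      ((iq4.const_mul 8).add (integrable_const _)) (fun M => ae_of_all _ fun x => ?_)
      (ae_of_all _ fun x => (hfl x).pow 4)
    rw [Real.norm_eq_abs, abs_of_nonneg (by positivity)]
    exact hf4 M x

lemma norm_exp_mul_I_sub_exp_mul_I_le (x y : ℝ) :
    ‖Complex.exp (x * Complex.I) - Complex.exp (y * Complex.I)‖ ≤ |x - y| := by
  have e : Complex.exp (x * Complex.I) - Complex.exp (y * Complex.I) =
      Complex.exp (y * Complex.I) * (Complex.exp (Complex.I * (x - y : ℝ)) - 1) := by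
    rw [mul_sub, ← Complex.exp_add, mul_one]
    push_cast
    ring_nf
  rw [e, norm_mul, Complex.norm_exp_ofReal_mul_I, one_mul]
  exact Real.norm_exp_I_mul_ofReal_sub_one_le

lemma norm_integral_exp_sub_le {Ω : Type*} [MeasurableSpace Ω] {P : Measure Ω}
    [IsProbabilityMeasure P] {X Y D : Ω → ℝ} (hX : Measurable X) (hY : Measurable Y) (t : ℝ)
    (hD : Integrable D P) (h : ∀ ω, |X ω - Y ω| ≤ D ω) :
    ‖∫ ω, Complex.exp ((t * X ω : ℝ) * Complex.I) ∂P -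
      ∫ ω, Complex.exp ((t * Y ω : ℝ) * Complex.I) ∂P‖ ≤ |t| * ∫ ω, D ω ∂P := by
  have hi : ∀ {Z : Ω → ℝ}, Measurable Z →
      Integrable (fun ω => Complex.exp ((t * Z ω : ℝ) * Complex.I)) P := fun {Z} hZ =>
    Integrable.of_bound (Measurable.aestronglyMeasurable (by fun_prop)) 1
      (ae_of_all _ fun ω => (Complex.norm_exp_ofReal_mul_I _).le)
  rw [← integral_sub (hi hX) (hi hY), ← integral_const_mul]
  refine norm_integral_le_of_norm_le (hD.const_mul _) (ae_of_all _ fun ω => ?_)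
  refine (norm_exp_mul_I_sub_exp_mul_I_le _ _).trans ?_
  rw [← mul_sub, abs_mul]
  exact mul_le_mul_of_nonneg_left (h ω) (abs_nonneg t)

namespace IsAxisNoise

variable {Ω : Type*} [mΩ : MeasurableSpace Ω] {P : Measure Ω} [IsProbabilityMeasure P] {d : ℕ}
  {F : ℕ → MeasurableSpace Ω} {J : ℕ → Ω → Fin d} {R : ℕ → Ω → ℝ} {μ : Measure ℝ}

/-- Replacing the step lengths `R i` by `f (R i)` changes the characteristic function little if `f`
is close to the identity. -/
lemma norm_charFun_sub_charFun_comp_le (h : IsAxisNoise P F J R μ) (h2 : MemLp id 2 μ)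
    (h0 : ∫ x, x ∂μ = 0) {f : ℝ → ℝ} (hf : Measurable f) (hf2 : MemLp f 2 μ)
    (hf0 : ∫ x, f x ∂μ = 0) (s s' a b t : ℝ) (n : ℕ) {D : ℝ}
    (ha : a = 0 ∨ (MemLp (fun x => x ^ 2 - s - (f x ^ 2 - s')) 2 μ ∧
      ∫ x, (x ^ 2 - s - (f x ^ 2 - s')) ∂μ = 0 ∧
      ∫ x, (x ^ 2 - s - (f x ^ 2 - s')) ^ 2 ∂μ ≤ D)) :
    ‖∫ ω, Complex.exp ((t * ∑ i ∈ Finset.range n, increment J R s a b i ω : ℝ) * Complex.I) ∂P -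
      ∫ ω, Complex.exp ((t * ∑ i ∈ Finset.range n,
        increment J (fun i ω => f (R i ω)) s' a b i ω : ℝ) * Complex.I) ∂P‖ ≤
      |t| * (√(n * a ^ 2) * √D + √(2 * (b ^ 2 * n ^ 2 / d)) *
        (√(∫ x, (x - f x) ^ 2 ∂μ) * (√(∫ x, x ^ 2 ∂μ) + √(∫ x, f x ^ 2 ∂μ)))) := by
  have hp := h.isProbabilityMeasure
  have hcomp := h.comp hf
  have i1 : Integrable (fun x : ℝ => x) μ := h2.integrable one_le_two
  have hgd : MemLp (fun x => x - f x) 2 μ := MemLp.sub (f := fun x => x) h2 hf2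
  have hgd0 : ∫ x, (x - f x) ∂μ = 0 := by
    rw [integral_sub i1 (hf2.integrable one_le_two), h0, hf0, sub_zero]
  have hgm : Measurable (fun x : ℝ => x - f x) := measurable_id.sub hf
  have W1 := h.integral_sum_mul_walkNext_sq_le hgm hgd hgd0 measurable_id h2 h0 n
  have W2 := h.integral_sum_mul_walkNext_sq_le hf hf2 hf0 hgm hgd hgd0 n
  simp only [id] at W1
  set X1 : Ω → ℝ := fun ω => ∑ k ∈ Finset.range n, (R k ω - f (R k ω)) *
    walkNext J (fun k ω => R k ω) k ω with hX1
  set X2 : Ω → ℝ := fun ω => ∑ k ∈ Finset.range n, f (R k ω) *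
    walkNext J (fun k ω => R k ω - f (R k ω)) k ω with hX2
  set X0 : Ω → ℝ := fun ω => a * ∑ k ∈ Finset.range n,
    (R k ω ^ 2 - s - (f (R k ω) ^ 2 - s')) with hX0
  -- With `a = 0` the squares drop out, and no moment beyond the second is used.
  have B0 : Integrable X0 P ∧ ∫ ω, |X0 ω| ∂P ≤ √(n * a ^ 2) * √D := by
    rcases ha with rfl | ⟨ha1, ha2, ha3⟩
    · simp [hX0]
    · have W0 := h.integral_sum_sq (g := fun x => x ^ 2 - s - (f x ^ 2 - s')) (by fun_prop) ha1
        ha2 n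
      have hL : MemLp X0 2 P := W0.1.const_mul a
      refine ⟨hL.integrable one_le_two, (integral_abs_le_sqrt hL).trans ?_⟩
      rw [← Real.sqrt_mul (by positivity)]
      refine Real.sqrt_le_sqrt ?_
      simp only [hX0, mul_pow]
      rw [integral_const_mul, W0.2]
      calc _ ≤ a ^ 2 * (n * D) := by gcongr
        _ = _ := by ring
  have hc : ∀ u v w : ℝ, 0 ≤ u → 0 ≤ v → w ≤ u * v * ((n : ℝ) ^ 2 / (2 * d)) →
      |2 * b| * √w ≤ √(2 * (b ^ 2 * n ^ 2 / d)) * (√u * √v) := by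
    intro u v w hu hv hw
    rw [← Real.sqrt_sq_eq_abs, ← Real.sqrt_mul (sq_nonneg _), ← Real.sqrt_mul hu,
      ← Real.sqrt_mul (by positivity)]
    refine Real.sqrt_le_sqrt ?_
    calc (2 * b) ^ 2 * w ≤ (2 * b) ^ 2 * (u * v * ((n : ℝ) ^ 2 / (2 * d))) := by gcongr
      _ = _ := by
        rw [mul_comm (2 : ℝ) (d : ℝ), ← div_div]
        ring
  have nn : ∀ g : ℝ → ℝ, 0 ≤ ∫ x, g x ^ 2 ∂μ := fun g => integral_nonneg fun x => sq_nonneg _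
  have B1 : |2 * b| * ∫ ω, |X1 ω| ∂P ≤ √(2 * (b ^ 2 * n ^ 2 / d)) *
      (√(∫ x, (x - f x) ^ 2 ∂μ) * √(∫ x, x ^ 2 ∂μ)) :=
    (mul_le_mul_of_nonneg_left (integral_abs_le_sqrt W1.1) (abs_nonneg _)).trans
      (hc _ _ _ (nn _) (nn _) W1.2)
  have B2 : |2 * b| * ∫ ω, |X2 ω| ∂P ≤ √(2 * (b ^ 2 * n ^ 2 / d)) *
      (√(∫ x, f x ^ 2 ∂μ) * √(∫ x, (x - f x) ^ 2 ∂μ)) :=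
    (mul_le_mul_of_nonneg_left (integral_abs_le_sqrt W2.1) (abs_nonneg _)).trans
      (hc _ _ _ (nn _) (nn _) W2.2)
  have j1 := (W1.1.integrable one_le_two).abs.const_mul |2 * b|
  have j2 := (W2.1.integrable one_le_two).abs.const_mul |2 * b|
  have hmeas : ∀ {R' : ℕ → Ω → ℝ} {μ' : Measure ℝ} (s : ℝ), IsAxisNoise P F J R' μ' →
      Measurable (fun ω => ∑ i ∈ Finset.range n, increment J R' s a b i ω) := fun s h' =>
    Finset.measurable_fun_sum _ fun i _ => (h'.measurable_increment s a b i).mono (h'.le _) le_rfl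
  refine (norm_integral_exp_sub_le (D := fun ω => |X0 ω| + |2 * b| * |X1 ω| + |2 * b| * |X2 ω|)
    (hmeas s h) (hmeas s' hcomp) t ((B0.1.abs.add j1).add j2) fun ω => ?_).trans ?_
  -- The next coordinate is linear in the step lengths, so with `W` and `W'` for the two walks, `R W
  -- - f(R) W' = (R - f(R)) W + f(R) (W - W')`; both terms are collision sums with one small factor.
  · have e : ∑ i ∈ Finset.range n, increment J R s a b i ω -
        ∑ i ∈ Finset.range n, increment J (fun i ω => f (R i ω)) s' a b i ω =
        X0 ω + 2 * b * X1 ω + 2 * b * X2 ω := by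
      simp only [hX0, hX1, hX2, Finset.mul_sum, ← Finset.sum_sub_distrib,
        ← Finset.sum_add_distrib]
      refine Finset.sum_congr rfl fun k _ => ?_
      simp only [increment, walkNext, walkCoord_sub]
      ring
    rw [e]
    refine (abs_add_le _ _).trans (add_le_add ((abs_add_le _ _).trans ?_) (abs_mul _ _).le)
    exact add_le_add le_rfl (abs_mul _ _).le
  · refine mul_le_mul_of_nonneg_left ?_ (abs_nonneg t)
    rw [integral_add ?_ j2, integral_add B0.1.abs j1, integral_const_mul, integral_const_mul]
    · calc _ ≤ _ := add_le_add (add_le_add B0.2 B1) B2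
        _ = _ := by ring
    · exact B0.1.abs.add j1

end IsAxisNoise

lemma integral_sq_sub_const_sq {μ : Measure ℝ} [IsProbabilityMeasure μ] {g : ℝ → ℝ}
    (hg : MemLp g 2 μ) : ∫ x, (g x - ∫ y, g y ∂μ) ^ 2 ∂μ = ∫ x, g x ^ 2 ∂μ - (∫ x, g x ∂μ) ^ 2 := by
  have := variance_eq_sub hg
  rw [variance_eq_integral hg.1.aemeasurable] at this
  simpa using this

namespace IsAxisNoise

variable {Ω : Type*} [mΩ : MeasurableSpace Ω] {P : Measure Ω} [IsProbabilityMeasure P]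
  {R : ℕ → Ω → ℝ} {μ : Measure ℝ} {n : ℕ → ℕ} {a b : ℕ → ℝ} {A Q : ℝ}

/-- The limit of the characteristic functions of weighted combinations of the centered sum of
squares and the double sum over collisions. -/
theorem eventually_norm_charFun_sub_lt [IsProbabilityMeasure μ] (hn : Tendsto n atTop atTop)
    (ha : Tendsto (fun d => n d * a d ^ 2) atTop (𝓝 A))
    (hb : Tendsto (fun d : ℕ => b d ^ 2 * n d ^ 2 / d) atTop (𝓝 Q)) (hb0 : Tendsto b atTop (𝓝 0))
    (h2 : MemLp id 2 μ) (h0 : ∫ x, x ∂μ = 0)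
    (h4 : MemLp (fun x => x ^ 2) 2 μ ∨ ∀ d, a d = 0) (t : ℝ) {ε : ℝ} (hε : 0 < ε) :
    ∀ᶠ d : ℕ in atTop, ∀ (F : ℕ → MeasurableSpace Ω) (J : ℕ → Ω → Fin d),
      IsAxisNoise P F J R μ →
      ‖∫ ω, Complex.exp ((t * ∑ i ∈ Finset.range (n d),
          increment J R (∫ x, x ^ 2 ∂μ) (a d) (b d) i ω : ℝ) * Complex.I) ∂P -
        (Real.exp (-(t ^ 2 / 2 * (A * ∫ x, (x ^ 2 - ∫ y, y ^ 2 ∂μ) ^ 2 ∂μ +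
          2 * (∫ x, x ^ 2 ∂μ) ^ 2 * Q))) : ℂ)‖ < ε := by
  obtain ⟨f, hfm, hfB, hf0, hfd, hfs, hf4⟩ := exists_bounded_centered_approx μ h2 h0
  have hfL : ∀ M, MemLp (f M) 2 μ := by
    intro M
    obtain ⟨B, -, hB⟩ := hfB M
    exact MemLp.of_bound (hfm M).aestronglyMeasurable B (ae_of_all _ hB)
  have hfL2 : ∀ M, MemLp (fun x => f M x ^ 2) 2 μ := by
    intro M
    obtain ⟨B, -, hB⟩ := hfB M
    refine MemLp.of_bound ((hfm M).pow_const 2).aestronglyMeasurable (B ^ 2)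
      (ae_of_all _ fun x => ?_)
    rw [norm_pow]
    exact pow_le_pow_left₀ (norm_nonneg _) (hB x) 2
  set s := ∫ x, x ^ 2 ∂μ with hs
  set κ := ∫ x, (x ^ 2 - s) ^ 2 ∂μ with hκ
  set s' : ℕ → ℝ := fun M => ∫ x, f M x ^ 2 ∂μ with hs'
  set κ' : ℕ → ℝ := fun M => ∫ x, (f M x ^ 2 - s' M) ^ 2 ∂μ with hκ'
  -- Treats both alternatives for `h4` at once. If `a` vanishes then `A = 0`, so the variance of the
  -- truncated square need not converge.
  obtain ⟨D, hD, haD, hAκ⟩ : ∃ D : ℕ → ℝ, Tendsto D atTop (𝓝 0) ∧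
      (∀ M d, a d = 0 ∨ (MemLp (fun x => x ^ 2 - s - (f M x ^ 2 - s' M)) 2 μ ∧
      ∫ x, (x ^ 2 - s - (f M x ^ 2 - s' M)) ∂μ = 0 ∧
      ∫ x, (x ^ 2 - s - (f M x ^ 2 - s' M)) ^ 2 ∂μ ≤ D M)) ∧
      Tendsto (fun M => A * κ' M) atTop (𝓝 (A * κ)) := by
    rcases h4 with h4 | h4
    · obtain ⟨h5, h6⟩ := hf4 h4
      refine ⟨_, h5, fun M d => Or.inr ?_, ?_⟩
      · have hL := h4.sub (hfL2 M)
        have hint : ∫ x, (x ^ 2 - f M x ^ 2) ∂μ = s - s' M :=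
          integral_sub (h4.integrable one_le_two) ((hfL2 M).integrable one_le_two)
        have hL' : MemLp (fun x => x ^ 2 - f M x ^ 2) 2 μ := hL
        have e : ∀ x, x ^ 2 - s - (f M x ^ 2 - s' M) = x ^ 2 - f M x ^ 2 - (s - s' M) :=
          fun x => by ring
        simp only [e]
        refine ⟨hL'.sub (memLp_const _), ?_, ?_⟩
        · rw [integral_sub (hL'.integrable one_le_two) (integrable_const _), hint]
          simp
        · have := integral_sq_sub_const_sq hL'
          rw [hint] at this
          rw [this]
          linarith [sq_nonneg (s - s' M)]
      · refine Tendsto.const_mul A ?_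
        rw [hκ, hs, integral_sq_sub_const_sq h4]
        simp only [hκ', hs', fun M => integral_sq_sub_const_sq (hfL2 M), ← pow_mul]
        exact h6.sub (hfs.pow 2)
    · have hA : A = 0 := by
        refine tendsto_nhds_unique ha ?_
        simp [h4]
      refine ⟨fun _ => 0, tendsto_const_nhds, fun M d => Or.inl (h4 d), ?_⟩
      simp [hA]
  have hv : Tendsto (fun M => Real.exp (-(t ^ 2 / 2 * (A * κ' M + 2 * s' M ^ 2 * Q)))) atTop
      (𝓝 (Real.exp (-(t ^ 2 / 2 * (A * κ + 2 * s ^ 2 * Q))))) :=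
    (((hAκ.add (((hfs.pow 2).const_mul 2).mul_const Q)).const_mul _).neg).rexp
  have he : Tendsto (fun M => |t| * (√(A + 1) * √(D M) + √(2 * (Q + 1)) *
      (√(∫ x, (x - f M x) ^ 2 ∂μ) * (√s + √(s' M))))) atTop (𝓝 0) := by
    have := ((hD.sqrt.const_mul √(A + 1)).add ((hfd.sqrt.mul
      (hfs.sqrt.const_add √s)).const_mul √(2 * (Q + 1)))).const_mul |t|
    simpa using this
  have hε3 : 0 < ε / 3 := by positivity
  -- The truncation level is chosen before `d`: the replacement error is bounded uniformly once `n
  -- a²` and `b² n² / d` lie below `A + 1` and `Q + 1`.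
  obtain ⟨M, hM1, hM2⟩ := ((Metric.tendsto_nhds.1 hv (ε / 3) hε3).and
    (he.eventually_lt_const hε3)).exists
  obtain ⟨B, hB0, hB⟩ := hfB M
  have hmap0 : ∫ x, x ∂(μ.map (f M)) = 0 := by
    rw [integral_map (hfm M).aemeasurable (f := fun x => x) aestronglyMeasurable_id]
    exact hf0 M
  have hmap2 : ∫ x, x ^ 2 ∂(μ.map (f M)) = s' M := by
    rw [integral_map (hfm M).aemeasurable (by fun_prop)]
  have hmapκ : ∫ x, (x ^ 2 - s' M) ^ 2 ∂(μ.map (f M)) = κ' M := by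
    rw [integral_map (hfm M).aemeasurable (by fun_prop)]
  have hbdd := eventually_norm_charFun_sub_lt_of_bounded (P := P) (R := fun i ω => f M (R i ω))
    (μ := μ.map (f M)) hn ha hb hb0 (fun i ω => hB (R i ω)) hB0 hmap0 t hε3
  rw [hmap2, hmapκ] at hbdd
  filter_upwards [hbdd, ha.eventually_lt_const (lt_add_one A),
    hb.eventually_lt_const (lt_add_one Q)] with d hd1 hd2 hd3 F J h
  have n1 := hd1 F J (h.comp (hfm M))
  have n2 := h.norm_charFun_sub_charFun_comp_le h2 h0 (hfm M) (hfL M) (hf0 M) s (s' M) (a d) (b d)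
    t (n d) (haD M d)
  have n2' := n2.trans_lt (lt_of_le_of_lt (by
    refine mul_le_mul_of_nonneg_left (add_le_add ?_ ?_) (abs_nonneg t)
    · exact mul_le_mul_of_nonneg_right (Real.sqrt_le_sqrt hd2.le) (Real.sqrt_nonneg _)
    · refine mul_le_mul_of_nonneg_right (Real.sqrt_le_sqrt ?_) (by positivity)
      exact mul_le_mul_of_nonneg_left hd3.le zero_le_two) hM2)
  rw [dist_eq_norm, ← Complex.norm_real, Complex.ofReal_sub] at hM1
  calc _ ≤ _ := norm_sub_le_norm_sub_add_norm_sub _ _ _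
    _ ≤ _ := add_le_add le_rfl (norm_sub_le_norm_sub_add_norm_sub _ _ _)
    _ < ε / 3 + (ε / 3 + ε / 3) := add_lt_add n2' (add_lt_add n1 hM1)
    _ = ε := by ring

end IsAxisNoise

/-! ### Slowly varying functions -/

/-- The uniform convergence theorem for slowly varying functions in additive form. -/
lemma eventually_forall_abs_add_sub_le {f : ℝ → ℝ} (hf : Measurable f)
    (h : ∀ v, Tendsto (fun u => f (u + v) - f u) atTop (𝓝 0)) {ε : ℝ} (hε : 0 < ε) :
    ∀ᶠ u in atTop, ∀ v ∈ Set.Icc (0 : ℝ) 1, |f (u + v) - f u| ≤ ε := by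
  by_contra hcon
  rw [eventually_atTop] at hcon
  push Not at hcon
  choose u hu v hv huv using fun N : ℕ => hcon N
  have hut : Tendsto u atTop atTop := tendsto_atTop_mono hu tendsto_natCast_atTop_atTop
  have huvt : Tendsto (fun N => u N + v N) atTop atTop :=
    tendsto_atTop_mono (fun N => le_add_of_nonneg_right (hv N).1) hut
  -- Pointwise convergence implies convergence in measure on `[0, 2]`. The interval has length 2 so
  -- that both `z` and `z - v` stay inside it for `z` in `[1, 2]` and `v` in `[0, 1]`.
  set ν : Measure ℝ := volume.restrict (Set.Icc 0 2) with hν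
  have key : ∀ w : ℕ → ℝ, Tendsto w atTop atTop → ∀ᶠ N in atTop,
      volume {y ∈ Set.Icc (0 : ℝ) 2 | ε / 2 ≤ |f (w N + y) - f (w N)|} < ENNReal.ofReal (1 / 2) := by
    intro w hw
    have hm : TendstoInMeasure ν (fun N y => f (w N + y) - f (w N)) atTop (fun _ => 0) := by
      refine tendstoInMeasure_of_tendsto_ae (fun N => ?_) (ae_of_all _ fun y => (h y).comp hw)
      exact Measurable.aestronglyMeasurable (by fun_prop)
    have := (tendstoInMeasure_iff_norm.1 hm (ε / 2) (half_pos hε)).eventually_lt_const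
      (u := ENNReal.ofReal (1 / 2)) (by simp)
    filter_upwards [this] with N hN
    refine lt_of_le_of_lt (le_of_eq ?_) hN
    rw [hν, Measure.restrict_apply (measurableSet_le measurable_const (by fun_prop))]
    congr 1
    ext y
    simp [and_comm]
  obtain ⟨N, h1, h2⟩ := ((key u hut).and (key _ huvt)).exists
  set S1 := {y ∈ Set.Icc (0 : ℝ) 2 | ε / 2 ≤ |f (u N + y) - f (u N)|}
  set S2 := {y ∈ Set.Icc (0 : ℝ) 2 | ε / 2 ≤ |f (u N + v N + y) - f (u N + v N)|}
  -- The two exceptional sets have total measure below 1, so some `z` in `[1, 2]` avoids both.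
  -- Passing through `f (u + z)` then bounds `f (u + v) - f u` strictly by `ε`, a contradiction.
  have hlt : volume (S1 ∪ (fun z => z - v N) ⁻¹' S2) < volume (Set.Icc (1 : ℝ) 2) := by
    calc _ ≤ volume S1 + volume ((fun z => z - v N) ⁻¹' S2) := measure_union_le _ _
      _ = volume S1 + volume S2 := by
        simp only [sub_eq_add_neg, measure_preimage_add_right]
      _ < ENNReal.ofReal (1 / 2) + ENNReal.ofReal (1 / 2) := ENNReal.add_lt_add h1 h2
      _ = _ := by
        rw [← ENNReal.ofReal_add (by norm_num) (by norm_num), Real.volume_Icc]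
        norm_num
  obtain ⟨z, hz, hz'⟩ := Set.not_subset.1 (fun hsub => (measure_mono hsub).not_gt hlt)
  simp only [Set.mem_union, not_or, Set.mem_preimage] at hz'
  obtain ⟨hz1, hz2⟩ := hz'
  have hvN := hv N
  have g1 : |f (u N + z) - f (u N)| < ε / 2 := by
    by_contra hc
    exact hz1 ⟨⟨by linarith [hz.1], hz.2⟩, not_lt.1 hc⟩
  have g2 : |f (u N + z) - f (u N + v N)| < ε / 2 := by
    by_contra hc
    refine hz2 ⟨⟨by linarith [hz.1, hvN.2], by linarith [hz.2, hvN.1]⟩, ?_⟩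
    rw [show u N + v N + (z - v N) = u N + z by ring]
    exact not_lt.1 hc
  have g3 := huv N
  rw [abs_sub_comm] at g2
  have := abs_sub_le (f (u N + v N)) (f (u N + z)) (f (u N))
  linarith

/-- Beyond some point `f` changes by at most `ε / 2` over each unit interval, so it grows at most
linearly with slope `ε / 2`; the other half of `ε` absorbs the constants. -/
lemma eventually_abs_le_mul_of_tendsto_add_sub {f : ℝ → ℝ} (hf : Measurable f)
    (h : ∀ v, Tendsto (fun u => f (u + v) - f u) atTop (𝓝 0)) {ε : ℝ} (hε : 0 < ε) :
    ∀ᶠ u in atTop, |f u| ≤ ε * u := by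
  obtain ⟨U, hU⟩ := eventually_atTop.1 (eventually_forall_abs_add_sub_le hf h (half_pos hε))
  have claim : ∀ k : ℕ, ∀ u ∈ Set.Icc U (U + k), |f u - f U| ≤ k * (ε / 2) := by
    intro k
    induction k with
    | zero =>
      intro u hu
      have : u = U := le_antisymm (by simpa using hu.2) hu.1
      simp [this]
    | succ k ih =>
      intro u hu
      push_cast at hu ⊢
      rcases le_total u (U + 1) with h1 | h1
      · have := hU U le_rfl (u - U) ⟨by linarith [hu.1], by linarith⟩
        rw [add_sub_cancel] at this
        have hk : 0 ≤ (k : ℝ) * (ε / 2) := by positivity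
        linarith
      · have e1 := ih (u - 1) ⟨by linarith, by linarith [hu.2]⟩
        have e2 := hU (u - 1) (by linarith) 1 ⟨zero_le_one, le_rfl⟩
        rw [sub_add_cancel] at e2
        have := abs_sub_le (f u) (f (u - 1)) (f U)
        linarith
  filter_upwards [eventually_ge_atTop U, eventually_ge_atTop (2 / ε * (|f U| + (1 - U) * (ε / 2)))]
    with u h1 h2
  have e := claim ⌈u - U⌉₊ u ⟨h1, by linarith [Nat.le_ceil (u - U)]⟩
  have hceil : (⌈u - U⌉₊ : ℝ) ≤ u - U + 1 := (Nat.ceil_lt_add_one (by linarith)).le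
  have e2 : (⌈u - U⌉₊ : ℝ) * (ε / 2) ≤ (u - U + 1) * (ε / 2) := by gcongr
  have e3 : |f U| + (1 - U) * (ε / 2) ≤ ε / 2 * u := by
    calc _ = ε / 2 * (2 / ε * (|f U| + (1 - U) * (ε / 2))) := by field_simp
      _ ≤ _ := by gcongr
  have := abs_sub_abs_le_abs_sub (f u) (f U)
  nlinarith

/-- A slowly varying function is eventually between `x ^ (-ε)` and `x ^ ε`. -/
lemma IsSlowlyVarying.eventually_rpow_le {L : ℝ → ℝ} (hL : IsSlowlyVarying L) {ε : ℝ}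
    (hε : 0 < ε) : ∀ᶠ x in atTop, x ^ (-ε) ≤ L x ∧ L x ≤ x ^ ε := by
  -- In logarithmic coordinates slow variation is vanishing of the increments of `f`, and the power
  -- bounds say that `f u` is at most `ε u` in absolute value.
  set f : ℝ → ℝ := fun u => Real.log (L (Real.exp u)) with hf
  have hfm : Measurable f := Real.measurable_log.comp (hL.measurable.comp Real.measurable_exp)
  have hlim : ∀ v, Tendsto (fun u => f (u + v) - f u) atTop (𝓝 0) := by
    intro v
    have h1 := (hL.tendsto_ratio (Real.exp v) (Real.exp_pos v)).comp Real.tendsto_exp_atTop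
    have h2 := h1.log one_ne_zero
    rw [Real.log_one] at h2
    refine h2.congr' ?_
    have hp := Real.tendsto_exp_atTop.eventually hL.eventually_pos
    filter_upwards [hp, (tendsto_atTop_add_const_right atTop v tendsto_id).eventually hp]
      with u hu1 hu2
    simp only [id] at hu2
    simp only [Function.comp, hf, ← Real.exp_add, add_comm v u]
    exact Real.log_div hu2.ne' hu1.ne'
  filter_upwards [Real.tendsto_log_atTop.eventually
    (eventually_abs_le_mul_of_tendsto_add_sub hfm hlim hε), hL.eventually_pos,
    eventually_gt_atTop 0] with x h1 h2 h3
  simp only [hf, Real.exp_log h3] at h1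
  rw [abs_le] at h1
  rw [Real.rpow_def_of_pos h3, Real.rpow_def_of_pos h3]
  constructor
  · rw [← Real.le_log_iff_exp_le h2]
    linarith
  · rw [← Real.log_le_iff_le_exp h2]
    linarith

/-! ### From the random walk model to the axis noise -/

/-- Two independent sequences of independent σ-algebras form one independent family. -/
lemma iIndep_sumElim {Ω ι κ : Type*} {mΩ : MeasurableSpace Ω} {P : Measure Ω}
    {m : ι → MeasurableSpace Ω} {m' : κ → MeasurableSpace Ω} (h : iIndep m P) (h' : iIndep m' P)
    (hind : Indep (⨆ i, m i) (⨆ i, m' i) P) : iIndep (Sum.elim m m') P := by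
  rw [iIndep_iff]
  intro s f hf
  have e : (⋂ i ∈ s, f i) = (⋂ i ∈ s.toLeft, f (Sum.inl i)) ∩ ⋂ i ∈ s.toRight, f (Sum.inr i) := by
    ext ω
    simp [Sum.forall]
  have hl : ∀ i ∈ s.toLeft, MeasurableSet[m i] (f (Sum.inl i)) := fun i hi =>
    hf _ (Finset.mem_toLeft.1 hi)
  have hr : ∀ i ∈ s.toRight, MeasurableSet[m' i] (f (Sum.inr i)) := fun i hi =>
    hf _ (Finset.mem_toRight.1 hi)
  rw [e, (Indep_iff _ _ _).1 hind, h.meas_biInter hl, h'.meas_biInter hr,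
    Finset.prod_sum_eq_prod_toLeft_mul_prod_toRight]
  · exact Finset.measurableSet_biInter _ fun i hi => le_iSup m i _ (hl i hi)
  · exact Finset.measurableSet_biInter _ fun i hi => le_iSup m' i _ (hr i hi)

/-- The index of a standard basis vector. -/
def basisIndex {d : ℕ} (j₀ : Fin d) (v : EuclideanSpace ℝ (Fin d)) : Fin d :=
  open Classical in if h : ∃ j, v = EuclideanSpace.single j (1 : ℝ) then h.choose else j₀

lemma single_basisIndex {d : ℕ} (j₀ : Fin d) {v : EuclideanSpace ℝ (Fin d)}
    (h : ∃ j, v = EuclideanSpace.single j (1 : ℝ)) :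
    v = EuclideanSpace.single (basisIndex j₀ v) (1 : ℝ) := by
  rw [basisIndex, dif_pos h]
  exact h.choose_spec

/-- The function equals the default `j₀` off the finite set of basis vectors. -/
lemma measurable_basisIndex {d : ℕ} (j₀ : Fin d) : Measurable (basisIndex j₀) := by
  refine (measurable_const (a := j₀)).measurable_of_countable_ne ?_
  refine (Set.finite_range fun j : Fin d => EuclideanSpace.single j (1 : ℝ)).countable.mono ?_
  intro v hv
  by_contra hc
  refine hv ?_
  rw [basisIndex, dif_neg]
  rintro ⟨j, hj⟩
  exact hc ⟨j, hj.symm⟩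

lemma single_one_injective {d : ℕ} :
    Function.Injective fun j : Fin d => EuclideanSpace.single j (1 : ℝ) := by
  intro i j h
  by_contra hne
  have := congrArg (fun v : EuclideanSpace ℝ (Fin d) => v i) h
  simp [hne] at this

/-- The filtration generated by two sequences of random variables. -/
abbrev pastFiltration {Ω β γ : Type*} [MeasurableSpace β] [MeasurableSpace γ] (R : ℕ → Ω → β)
    (J : ℕ → Ω → γ) (k : ℕ) : MeasurableSpace Ω :=
  ⨆ x ∈ {x : ℕ ⊕ ℕ | Sum.elim id id x < k},
    Sum.elim (fun i => MeasurableSpace.comap (R i) inferInstance)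
      (fun i => MeasurableSpace.comap (J i) inferInstance) x

namespace IsAxisWalkModel

variable {Ω₀ Ω : Type*} [MeasurableSpace Ω₀] [MeasurableSpace Ω] {P₀ : Measure Ω₀}
  [IsProbabilityMeasure P₀] {P : Measure Ω} [IsProbabilityMeasure P] {R₀ : Ω₀ → ℝ} {R : ℕ → Ω → ℝ}
  {V : (d : ℕ) → ℕ → Ω → EuclideanSpace ℝ (Fin d)}

/-- The model prescribes only the probabilities of the `d` basis vectors; these are disjoint events
of probability `1 / d`, so nothing else has positive mass. -/
lemma ae_eq_single (h : IsAxisWalkModel P₀ P R₀ R V) {d : ℕ} (j₀ : Fin d) (k : ℕ) :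
    ∀ᵐ ω ∂P, V d k ω = EuclideanSpace.single (basisIndex j₀ (V d k ω)) (1 : ℝ) := by
  have hm : ∀ j : Fin d, MeasurableSet {ω | V d k ω = EuclideanSpace.single j (1 : ℝ)} := fun j =>
    h.measurable_V d k (measurableSet_singleton _)
  have h1 : P (⋃ j : Fin d, {ω | V d k ω = EuclideanSpace.single j (1 : ℝ)}) = 1 := by
    rw [measure_iUnion _ hm, tsum_fintype]
    · simp only [h.uniform_V, Finset.sum_const, Finset.card_univ, Fintype.card_fin, nsmul_eq_mul]
      refine ENNReal.mul_inv_cancel ?_ (ENNReal.natCast_ne_top d)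
      simpa using (Fin.pos j₀).ne'
    · intro i j hij
      refine Set.disjoint_left.2 fun ω hi hj => hij (single_one_injective ?_)
      exact (show V d k ω = _ from hi).symm.trans hj
  have h2 := (prob_compl_eq_zero_iff (MeasurableSet.iUnion hm)).2 h1
  filter_upwards [mem_ae_iff.2 h2] with ω hω
  exact single_basisIndex j₀ (by simpa using hω)

/-- The direction of the `k`-th step. -/
def stepIndex {d : ℕ} (V : (d : ℕ) → ℕ → Ω → EuclideanSpace ℝ (Fin d)) (j₀ : Fin d) (k : ℕ)
    (ω : Ω) : Fin d :=
  basisIndex j₀ (V d k ω)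

lemma measurable_stepIndex (h : IsAxisWalkModel P₀ P R₀ R V) {d : ℕ} (j₀ : Fin d) (k : ℕ) :
    Measurable (stepIndex V j₀ k) :=
  (measurable_basisIndex j₀).comp (h.measurable_V d k)

lemma isAxisNoise (h : IsAxisWalkModel P₀ P R₀ R V) {d : ℕ} (j₀ : Fin d) :
    IsAxisNoise P (pastFiltration R (stepIndex V j₀)) (stepIndex V j₀) R (P₀.map R₀) := by
  set J := stepIndex V j₀ with hJ
  set m : ℕ ⊕ ℕ → MeasurableSpace Ω :=
    Sum.elim (fun i => MeasurableSpace.comap (R i) inferInstance)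
      (fun i => MeasurableSpace.comap (J i) inferInstance) with hm
  have hJm : ∀ k, Measurable (J k) := h.measurable_stepIndex j₀
  have hmle : ∀ x, m x ≤ ‹MeasurableSpace Ω› := by
    rintro (i | i)
    · exact (h.measurable_R i).comap_le
    · exact (hJm i).comap_le
  have hmi : iIndep m P := by
    refine iIndep_sumElim h.indep_R
      ((h.indep_V d).comp (fun _ => basisIndex j₀) fun _ => measurable_basisIndex j₀) ?_
    refine indep_of_indep_of_le_left (indep_of_indep_of_le_right (h.indep_R_V d) ?_) ?_
    · refine iSup_le fun i => Measurable.comap_le ?_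
      exact (measurable_basisIndex j₀).comp
        ((measurable_pi_apply i).comp (comap_measurable fun ω i => V d i ω))
    · refine iSup_le fun i => Measurable.comap_le ?_
      exact (measurable_pi_apply i).comp (comap_measurable fun ω i => R i ω)
  have hF : ∀ k, pastFiltration R J k = ⨆ x ∈ {x : ℕ ⊕ ℕ | Sum.elim id id x < k}, m x :=
    fun k => rfl
  have hle : ∀ {x : ℕ ⊕ ℕ} {k : ℕ}, Sum.elim id id x < k → m x ≤ pastFiltration R J k :=
    fun {x k} hx => le_iSup₂ (f := fun x (_ : x ∈ {x : ℕ ⊕ ℕ | Sum.elim id id x < k}) => m x) x hx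
  refine
    { le := fun k => iSup₂_le fun x _ => hmle x
      mono := fun k l hkl => iSup₂_le fun x hx => hle (lt_of_lt_of_le hx hkl)
      measurable_R := fun k => measurable_iff_comap_le.2 (hle (x := Sum.inl k) k.lt_succ_self)
      measurable_J := fun k => measurable_iff_comap_le.2 (hle (x := Sum.inr k) k.lt_succ_self)
      indep_R := fun k => ?_
      indep_J := fun k => ?_
      uniform := fun k j => ?_
      law := fun k => (h.identDistrib_R k).map_eq }
  -- All `R i` and `J i` form one independent family indexed by `ℕ ⊕ ℕ`, and independence of the
  -- present from the past is independence of disjoint blocks of indices.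
  · have := indep_iSup_of_disjoint hmle hmi (S := {Sum.inl k})
      (T := {x : ℕ ⊕ ℕ | Sum.elim id id x < k} ∪ {Sum.inr k}) (by simp)
    rw [iSup_union, iSup_singleton, iSup_singleton] at this
    exact this
  · have := indep_iSup_of_disjoint hmle hmi (S := {Sum.inr k})
      (T := {x : ℕ ⊕ ℕ | Sum.elim id id x < k}) (by simp)
    rw [iSup_singleton] at this
    exact this
  · have e : P (J k ⁻¹' {j}) = (d : ENNReal)⁻¹ := by
      rw [← h.uniform_V d k j]
      refine measure_congr ?_
      filter_upwards [h.ae_eq_single j₀ k] with ω hω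
      refine propext ⟨fun hj => ?_, fun hj => ?_⟩
      · have hj' : basisIndex j₀ (V d k ω) = j := hj
        rw [hj'] at hω
        exact hω
      · exact single_one_injective (hω.symm.trans hj)
    rw [measureReal_def, e]
    simp

lemma ae_norm_axisWalk_sq (h : IsAxisWalkModel P₀ P R₀ R V) {d : ℕ} (j₀ : Fin d) (n : ℕ) :
    ∀ᵐ ω ∂P, ‖axisWalk R V d n ω‖ ^ 2 = ∑ i ∈ Finset.range n, R i ω ^ 2 +
      2 * ∑ i ∈ Finset.range n, R i ω * walkNext (stepIndex V j₀) R i ω := by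
  filter_upwards [ae_all_iff.2 (h.ae_eq_single j₀)] with ω hω
  rw [← sum_walkCoord_sq, EuclideanSpace.norm_sq_eq]
  refine Finset.sum_congr rfl fun j _ => ?_
  rw [Real.norm_eq_abs, sq_abs]
  congr 1
  simp only [axisWalk, walkCoord, WithLp.ofLp_sum, Finset.sum_apply, WithLp.ofLp_smul,
    Pi.smul_apply, smul_eq_mul]
  refine Finset.sum_congr rfl fun i _ => ?_
  congr 1
  conv_lhs => rw [hω i]
  simp only [stepIndex, PiLp.single_apply, eq_comm]

lemma measurable_axisWalk (h : IsAxisWalkModel P₀ P R₀ R V) (d n : ℕ) :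
    Measurable (axisWalk R V d n) :=
  Finset.measurable_fun_sum _ fun i _ => (h.measurable_R i).smul (h.measurable_V d i)

lemma aestronglyMeasurable (h : IsAxisWalkModel P₀ P R₀ R V) : AEStronglyMeasurable R₀ P₀ :=
  (h.identDistrib_R 0).aemeasurable_snd.aestronglyMeasurable

lemma memLp_two (h : IsAxisWalkModel P₀ P R₀ R V) : MemLp R₀ 2 P₀ := by
  rw [memLp_two_iff_integrable_sq h.aestronglyMeasurable]
  -- A non-integrable function has integral 0 by convention, which is incompatible with second
  -- moment 1.
  by_contra hc
  have := h.second_moment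
  rw [integral_undef hc] at this
  exact zero_ne_one this

lemma integral_map_R₀ (h : IsAxisWalkModel P₀ P R₀ R V) {g : ℝ → ℝ} (hg : Continuous g) :
    ∫ x, g x ∂(P₀.map R₀) = ∫ ω, g (R₀ ω) ∂P₀ :=
  integral_map h.aestronglyMeasurable.aemeasurable hg.aestronglyMeasurable

lemma memLp_map_R₀ (h : IsAxisWalkModel P₀ P R₀ R V) {g : ℝ → ℝ} (hg : Continuous g)
    {p : ENNReal} (hp : MemLp (fun ω => g (R₀ ω)) p P₀) : MemLp g p (P₀.map R₀) :=
  (memLp_map_measure_iff hg.aestronglyMeasurable h.aestronglyMeasurable.aemeasurable).2 hp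

/-- Second moment of the sum over collisions. -/
lemma integral_norm_sq_sub_sum_sq_le (h : IsAxisWalkModel P₀ P R₀ R V) {d : ℕ} (j₀ : Fin d)
    (n : ℕ) :
    MemLp (fun ω => ‖axisWalk R V d n ω‖ ^ 2 - ∑ i ∈ Finset.range n, R i ω ^ 2) 2 P ∧
    ∫ ω, (‖axisWalk R V d n ω‖ ^ 2 - ∑ i ∈ Finset.range n, R i ω ^ 2) ^ 2 ∂P ≤
      2 * (n ^ 2 / d) := by
  have h2 := h.memLp_map_R₀ continuous_id h.memLp_two
  have h0 : ∫ x, id x ∂(P₀.map R₀) = 0 := (h.integral_map_R₀ continuous_id).trans h.mean_zero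
  have h1 : ∫ x, id x ^ 2 ∂(P₀.map R₀) = 1 :=
    (h.integral_map_R₀ (continuous_pow 2)).trans h.second_moment
  have := (h.isAxisNoise j₀).integral_sum_mul_walkNext_sq_le measurable_id h2 h0 measurable_id h2
    h0 n
  rw [h1] at this
  simp only [id] at this
  have e : (fun ω => ‖axisWalk R V d n ω‖ ^ 2 - ∑ i ∈ Finset.range n, R i ω ^ 2) =ᵐ[P]
      fun ω => 2 * ∑ i ∈ Finset.range n, R i ω * walkNext (stepIndex V j₀) R i ω := by
    filter_upwards [h.ae_norm_axisWalk_sq j₀ n] with ω hω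
    rw [hω]
    ring
  refine ⟨(memLp_congr_ae e).2 (this.1.const_mul 2), ?_⟩
  rw [integral_congr_ae (g := fun ω => (2 : ℝ) ^ 2 * (∑ i ∈ Finset.range n,
    R i ω * walkNext (stepIndex V j₀) R i ω) ^ 2) (by
      filter_upwards [e] with ω hω
      rw [hω, mul_pow]), integral_const_mul]
  calc _ ≤ (2 : ℝ) ^ 2 * (1 * 1 * ((n : ℝ) ^ 2 / (2 * d))) := by
        gcongr
        exact this.2
    _ = _ := by
        rw [mul_comm (2 : ℝ) (d : ℝ), ← div_div]
        ring

end IsAxisWalkModel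

/-! ### Convergence in law and in probability -/

section Law

variable {Ω : Type*} [MeasurableSpace Ω] {P : Measure Ω} [IsProbabilityMeasure P]
  {ν : Measure ℝ} [IsProbabilityMeasure ν]

lemma convergesInLaw_of_tendsto_charFun {X : ℕ → Ω → ℝ} (hX : ∀ d, AEMeasurable (X d) P)
    (h : ∀ t : ℝ, Tendsto (fun d => ∫ ω, Complex.exp ((t * X d ω : ℝ) * Complex.I) ∂P) atTop
      (𝓝 (charFun ν t))) : ConvergesInLaw P X ν where
  forall_aemeasurable := hX
  aemeasurable_limit := aemeasurable_id
  tendsto := by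
    refine ProbabilityMeasure.tendsto_of_tendsto_charFun fun t => ?_
    simp only [ProbabilityMeasure.coe_mk, Measure.map_id]
    refine (h t).congr fun d => ?_
    rw [charFun_apply_real, integral_map (hX d) (by fun_prop)]
    simp

lemma ConvergesInLaw.comp {X : ℕ → Ω → ℝ} (h : ConvergesInLaw P X ν) {n : ℕ → ℕ}
    (hn : Tendsto n atTop atTop) : ConvergesInLaw P (fun d => X (n d)) ν where
  forall_aemeasurable d := h.forall_aemeasurable (n d)
  aemeasurable_limit := aemeasurable_id
  tendsto := h.tendsto.comp hn

lemma ConvergesInLaw.of_sub {X Y : ℕ → Ω → ℝ} (h : ConvergesInLaw P X ν)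
    (hY : ∀ d, AEMeasurable (Y d) P) (hXY : TendstoInMeasure P (Y - X) atTop 0) :
    ConvergesInLaw P Y ν :=
  tendstoInDistribution_of_tendstoInMeasure_sub Y id h hXY hY

/-- A sequence that converges in law, multiplied by a null sequence, tends to zero in
probability. -/
lemma ConvergesInLaw.tendstoInMeasure_mul {X : ℕ → Ω → ℝ} (h : ConvergesInLaw P X ν)
    {r : ℕ → ℝ} (hr : Tendsto r atTop (𝓝 0)) :
    TendstoInMeasure P (fun d ω => r d * X d ω) atTop 0 := by
  have hX := h.forall_aemeasurable
  have hp : ∀ d, IsProbabilityMeasure (P.map (X d)) := fun d =>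
    Measure.isProbabilityMeasure_map (hX d)
  -- Convergence of characteristic functions to a continuous one gives tightness, so `X d` exceeds a
  -- fixed `K` only with probability at most `δ`; for large `d` the factor `r d` brings the rest
  -- below `ε`.
  have htight : IsTightMeasureSet (Set.range fun d => P.map (X d)) := by
    refine isTightMeasureSet_of_tendsto_charFun (f := charFun ν) (by fun_prop) fun t => ?_
    have := ProbabilityMeasure.tendsto_iff_tendsto_charFun.1 h.tendsto t
    simpa only [ProbabilityMeasure.coe_mk, Measure.map_id] using this
  have hK := tendsto_measure_norm_gt_of_isTightMeasureSet htight
  rw [tendstoInMeasure_iff_norm]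
  intro ε hε
  rw [ENNReal.tendsto_nhds_zero]
  intro δ hδ
  obtain ⟨K, hK1, hK0⟩ := (((ENNReal.tendsto_nhds_zero.1 hK) δ hδ).and
    (eventually_gt_atTop (0 : ℝ))).exists
  have hr' : ∀ᶠ d in atTop, |r d| < ε / K := by
    have := hr.abs
    rw [abs_zero] at this
    exact this.eventually_lt_const (by positivity)
  filter_upwards [hr'] with d hd
  calc P {ω | ε ≤ ‖r d * X d ω - (0 : Ω → ℝ) ω‖} ≤ P (X d ⁻¹' {x | K < ‖x‖}) := by
        refine measure_mono fun ω hω => ?_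
        simp only [Set.mem_ofPred_eq, Pi.zero_apply, sub_zero, norm_mul, Real.norm_eq_abs] at hω
        simp only [Set.mem_preimage, Set.mem_ofPred_eq, Real.norm_eq_abs]
        by_contra hc
        have h1 : |r d| * |X d ω| ≤ |r d| * K := by gcongr; exact not_lt.1 hc
        have h2 : |r d| * K < ε := (lt_div_iff₀ hK0).1 hd
        linarith
    _ = P.map (X d) {x | K < ‖x‖} :=
        (Measure.map_apply_of_aemeasurable (hX d)
          (measurableSet_lt measurable_const measurable_norm)).symm
    _ ≤ ⨆ μ ∈ Set.range fun d => P.map (X d), μ {x | K < ‖x‖} :=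
        le_iSup₂ (f := fun (μ : Measure ℝ) (_ : μ ∈ Set.range fun d => P.map (X d)) =>
          μ {x | K < ‖x‖}) (P.map (X d)) ⟨d, rfl⟩
    _ ≤ δ := hK1

lemma tendstoInMeasure_zero_of_integral_sq {X : ℕ → Ω → ℝ}
    (hX : ∀ᶠ d in atTop, MemLp (X d) 2 P)
    (h : Tendsto (fun d => ∫ ω, X d ω ^ 2 ∂P) atTop (𝓝 0)) : TendstoInMeasure P X atTop 0 := by
  rw [tendstoInMeasure_iff_measureReal_norm]
  intro ε hε
  refine squeeze_zero' (Eventually.of_forall fun d => measureReal_nonneg) ?_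
    (by simpa using h.div_const (ε ^ 2))
  filter_upwards [hX] with d hd
  rw [le_div_iff₀ (by positivity), mul_comm]
  refine le_trans ?_ (mul_meas_ge_le_integral_of_nonneg (ae_of_all _ fun ω => sq_nonneg (X d ω))
    hd.integrable_sq (ε ^ 2))
  refine mul_le_mul_of_nonneg_left (measureReal_mono fun ω hω => ?_) (sq_nonneg ε)
  simp only [Set.mem_ofPred_eq, Pi.zero_apply, sub_zero, Real.norm_eq_abs] at hω ⊢
  rw [← sq_abs (X d ω)]
  exact pow_le_pow_left₀ hε.le hω 2

end Law

/-! ### The central limit theorem for the walk -/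

namespace IsAxisWalkModel

variable {Ω₀ Ω : Type*} [MeasurableSpace Ω₀] [MeasurableSpace Ω] {P₀ : Measure Ω₀}
  [IsProbabilityMeasure P₀] {P : Measure Ω} [IsProbabilityMeasure P] {R₀ : Ω₀ → ℝ} {R : ℕ → Ω → ℝ}
  {V : (d : ℕ) → ℕ → Ω → EuclideanSpace ℝ (Fin d)} {n : ℕ → ℕ} {a b : ℕ → ℝ} {A Q : ℝ}

/-- Central limit theorem for weighted combinations of the centered sum of squares and the sum over
collisions. -/
theorem convergesInLaw_gaussianReal (h : IsAxisWalkModel P₀ P R₀ R V)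
    (hn : Tendsto n atTop atTop) (ha : Tendsto (fun d => n d * a d ^ 2) atTop (𝓝 A))
    (hb : Tendsto (fun d : ℕ => b d ^ 2 * n d ^ 2 / d) atTop (𝓝 Q)) (hb0 : Tendsto b atTop (𝓝 0))
    (h4 : Integrable (fun ω => R₀ ω ^ 4) P₀ ∨ ∀ d, a d = 0) :
    ConvergesInLaw P (fun d ω => a d * (∑ i ∈ Finset.range (n d), R i ω ^ 2 - n d) +
      b d * (‖axisWalk R V d (n d) ω‖ ^ 2 - ∑ i ∈ Finset.range (n d), R i ω ^ 2))
      (gaussianReal 0 (A * variance (fun ω => R₀ ω ^ 2) P₀ + 2 * Q).toNNReal) := by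
  have hp : IsProbabilityMeasure (P₀.map R₀) :=
    Measure.isProbabilityMeasure_map h.aestronglyMeasurable.aemeasurable
  have h2 := h.memLp_map_R₀ continuous_id h.memLp_two
  have h0 : ∫ x, x ∂(P₀.map R₀) = 0 := (h.integral_map_R₀ continuous_id).trans h.mean_zero
  have h1 : ∫ x, x ^ 2 ∂(P₀.map R₀) = 1 :=
    (h.integral_map_R₀ (continuous_pow 2)).trans h.second_moment
  have hvar : ∫ x, (x ^ 2 - 1) ^ 2 ∂(P₀.map R₀) = variance (fun ω => R₀ ω ^ 2) P₀ := by
    rw [h.integral_map_R₀ (g := fun x => (x ^ 2 - 1) ^ 2) (by fun_prop),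
      variance_eq_integral (h.aestronglyMeasurable.aemeasurable.pow_const 2), h.second_moment]
  have h4' : MemLp (fun x => x ^ 2) 2 (P₀.map R₀) ∨ ∀ d, a d = 0 := by
    refine h4.imp_left fun h4 => h.memLp_map_R₀ (continuous_pow 2) ?_
    refine (memLp_two_iff_integrable_sq (h.aestronglyMeasurable.pow 2)).2 ?_
    simpa only [Pi.pow_apply, ← pow_mul] using h4
  have hA : 0 ≤ A := ge_of_tendsto' ha fun d => by positivity
  have hQ : 0 ≤ Q := ge_of_tendsto' hb fun d => by positivity
  have hv : 0 ≤ A * variance (fun ω => R₀ ω ^ 2) P₀ + 2 * Q := by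
    have := variance_nonneg (fun ω => R₀ ω ^ 2) P₀
    positivity
  have hR := h.measurable_R
  have hS := h.measurable_axisWalk
  refine convergesInLaw_of_tendsto_charFun (fun d => ?_) fun t => ?_
  · refine Measurable.aemeasurable (.add (.const_mul ?_ _) (.const_mul ?_ _))
    · exact (Finset.measurable_fun_sum _ fun i _ => (hR i).pow_const 2).sub_const _
    · exact ((hS d _).norm.pow_const 2).sub
        (Finset.measurable_fun_sum _ fun i _ => (hR i).pow_const 2)
  · rw [Metric.tendsto_nhds]
    intro ε hε
    have key := IsAxisNoise.eventually_norm_charFun_sub_lt (P := P) (R := R) hn ha hb hb0 h2 h0 h4'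
      t hε
    filter_upwards [key, eventually_gt_atTop 0] with d hd hd0
    have := hd _ _ (h.isAxisNoise ⟨0, hd0⟩)
    rw [h1, hvar] at this
    rw [dist_eq_norm]
    refine lt_of_eq_of_lt ?_ this
    congr 2
    · refine integral_congr_ae ?_
      filter_upwards [h.ae_norm_axisWalk_sq ⟨0, hd0⟩ (n d)] with ω hω
      rw [hω]
      congr 4
      simp only [IsAxisNoise.increment, Finset.sum_add_distrib, ← Finset.mul_sum,
        Finset.sum_sub_distrib, Finset.sum_const, Finset.card_range, nsmul_eq_mul]
      ring
    · rw [charFun_gaussianReal, Complex.ofReal_exp]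
      congr 1
      rw [Real.coe_toNNReal _ hv]
      push_cast
      ring

end IsAxisWalkModel

/-! ### Asymptotics of the normalising sequences -/

/-- Above the critical power the fluctuations of the sum of squares are negligible. -/
lemma IsSlowlyVarying.tendsto_rpow_mul_div_sqrt {L : ℝ → ℝ} (hL : IsSlowlyVarying L) {α δ : ℝ}
    (h1 : 1 < α) (hδ : 0 < δ) {n : ℕ → ℕ} (hn : Tendsto n atTop atTop)
    (h : ∀ᶠ d : ℕ in atTop, (d : ℝ) ^ (α / (2 * α - 2) + δ) < n d) :
    Tendsto (fun d : ℕ => (n d : ℝ) ^ (1 / α) * L (n d) / √(2 * (n d : ℝ) ^ 2 / d)) atTop (𝓝 0) := by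
  set β := α / (2 * α - 2) with hβ
  have hα : 0 < 2 * α - 2 := by linarith
  have hβ0 : 0 < β := by positivity
  have hβα : 1 / (2 * β) = 1 - 1 / α := by
    rw [hβ]
    field_simp
  -- Half of the gap in the exponents: `√d` is at most `n^(1 / (2 (β + δ)))`, so the exponent of `n`
  -- before the slowly varying factor is `-2 ε`, and `L(n) ≤ n^ε` leaves `-ε`.
  set ε := (1 - 1 / α - 1 / (2 * (β + δ))) / 2 with hε
  have hε0 : 0 < ε := by
    have : 1 / (2 * (β + δ)) < 1 / (2 * β) :=
      one_div_lt_one_div_of_lt (by positivity) (by linarith)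
    rw [hε]
    linarith
  have hnr : Tendsto (fun d => (n d : ℝ)) atTop atTop := tendsto_natCast_atTop_atTop.comp hn
  refine squeeze_zero' ?_ ?_ ((tendsto_rpow_neg_atTop hε0).comp hnr)
  · filter_upwards [hnr.eventually hL.eventually_pos] with d hd
    positivity
  · filter_upwards [hnr.eventually (hL.eventually_rpow_le hε0), hnr.eventually_gt_atTop 0, h,
      eventually_gt_atTop 0] with d hd1 hd2 hd3 hd4
    have hd : (0 : ℝ) < d := Nat.cast_pos.2 hd4
    have hsd : √(d : ℝ) ≤ (n d : ℝ) ^ (1 / (2 * (β + δ))) := by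
      have := Real.rpow_le_rpow (by positivity) hd3.le (z := 1 / (2 * (β + δ))) (by positivity)
      rw [← Real.rpow_mul hd.le] at this
      rw [Real.sqrt_eq_rpow]
      convert this using 2
      field_simp
    have hsn : (n d : ℝ) / √d ≤ √(2 * (n d : ℝ) ^ 2 / d) := by
      rw [Real.sqrt_div (by positivity)]
      gcongr
      refine Real.le_sqrt_of_sq_le ?_
      nlinarith [sq_nonneg (n d : ℝ)]
    have hL0 : 0 ≤ L (n d) := (Real.rpow_nonneg hd2.le _).trans hd1.1
    calc _ ≤ (n d : ℝ) ^ (1 / α) * (n d : ℝ) ^ ε / ((n d : ℝ) / √d) := by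
          gcongr
          exact hd1.2
      _ = (n d : ℝ) ^ (1 / α) * (n d : ℝ) ^ ε * √d * (n d : ℝ) ^ (-1 : ℝ) := by
          rw [Real.rpow_neg_one]
          field_simp
      _ ≤ (n d : ℝ) ^ (1 / α) * (n d : ℝ) ^ ε * (n d : ℝ) ^ (1 / (2 * (β + δ))) *
          (n d : ℝ) ^ (-1 : ℝ) := by gcongr
      _ = (n d : ℝ) ^ (-ε) := by
          rw [← Real.rpow_add hd2, ← Real.rpow_add hd2, ← Real.rpow_add hd2]
          congr 1
          rw [hε]
          ring

/-- Below the critical power the sum over collisions is negligible. -/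
lemma IsSlowlyVarying.tendsto_inv_rpow_mul_sq {L : ℝ → ℝ} (hL : IsSlowlyVarying L) {α δ : ℝ}
    (h1 : 1 < α) (hδ : 0 < δ) {n : ℕ → ℕ} (hn : Tendsto n atTop atTop)
    (h : ∀ᶠ d : ℕ in atTop, (n d : ℝ) < (d : ℝ) ^ (α / (2 * α - 2) - δ)) :
    Tendsto (fun d : ℕ => ((n d : ℝ) ^ (1 / α) * L (n d))⁻¹ ^ 2 * ((n d : ℝ) ^ 2 / d)) atTop
      (𝓝 0) := by
  set β := α / (2 * α - 2) with hβ
  have hα : 0 < 2 * α - 2 := by linarith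
  have hβ0 : 0 < β := by positivity
  have hβα : 2 - 2 * (1 / α) = 1 / β := by
    rw [hβ]
    field_simp
  have hnr : Tendsto (fun d => (n d : ℝ)) atTop atTop := tendsto_natCast_atTop_atTop.comp hn
  -- Otherwise the assumed bound would keep `n` below 1, although `n` tends to infinity.
  have hβδ : 0 < β - δ := by
    by_contra hc
    obtain ⟨d, hd1, hd2, hd3⟩ := (h.and ((hnr.eventually_ge_atTop 1).and
      (eventually_ge_atTop 1))).exists
    have : (d : ℝ) ^ (β - δ) ≤ 1 :=
      Real.rpow_le_one_of_one_le_of_nonpos (by exact_mod_cast hd3) (not_lt.1 hc)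
    linarith
  -- Chosen so that `(β - δ) (1 / β + 2 ε) - 1 = -δ / (2 β)`: the slowly varying factor costs half
  -- of the gain `δ / β`.
  set ε := δ / (4 * β * (β - δ)) with hε
  have hε0 : 0 < ε := by positivity
  have hη : 0 < δ / (2 * β) := by positivity
  refine squeeze_zero' (Eventually.of_forall fun d => by positivity) ?_
    ((tendsto_rpow_neg_atTop hη).comp tendsto_natCast_atTop_atTop)
  filter_upwards [hnr.eventually (hL.eventually_rpow_le hε0), hnr.eventually_gt_atTop 0, h,
    eventually_gt_atTop 0] with d hd1 hd2 hd3 hd4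
  have hd : (0 : ℝ) < d := Nat.cast_pos.2 hd4
  have hL0 : 0 < L (n d) := (Real.rpow_pos_of_pos hd2 _).trans_le hd1.1
  have e0 : ((n d : ℝ) ^ (1 / α) * L (n d))⁻¹ ≤ (n d : ℝ) ^ (ε - 1 / α) := by
    rw [show ε - 1 / α = -(1 / α + -ε) by ring, Real.rpow_neg hd2.le, Real.rpow_add hd2]
    gcongr
    exact hd1.1
  calc _ ≤ ((n d : ℝ) ^ (ε - 1 / α)) ^ 2 * ((n d : ℝ) ^ 2 / d) := by
        gcongr
    _ = (n d : ℝ) ^ (1 / β + 2 * ε) * (d : ℝ) ^ (-1 : ℝ) := by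
        rw [← Real.rpow_natCast, ← Real.rpow_natCast, ← Real.rpow_mul hd2.le, Real.rpow_neg_one,
          ← mul_div_assoc, ← Real.rpow_add hd2, div_eq_mul_inv]
        congr 2
        push_cast
        rw [← hβα]
        ring
    _ ≤ ((d : ℝ) ^ (β - δ)) ^ (1 / β + 2 * ε) * (d : ℝ) ^ (-1 : ℝ) := by
        gcongr
    _ = (d : ℝ) ^ (-(δ / (2 * β))) := by
        rw [← Real.rpow_mul hd.le, ← Real.rpow_add hd]
        congr 1
        rw [hε]
        field_simp
        ring

/-- For `α < 2` the critical exponent is at least 1, so exceeding it by `δ` makes `n / d` grow at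
least like `d^δ`. -/
lemma tendsto_div_atTop_of_rpow_lt {α δ : ℝ} (h1 : 1 < α) (h2 : α < 2) (hδ : 0 < δ) {n : ℕ → ℕ}
    (h : ∀ᶠ d : ℕ in atTop, (d : ℝ) ^ (α / (2 * α - 2) + δ) < n d) :
    Tendsto (fun d : ℕ => (n d : ℝ) / d) atTop atTop := by
  have hβ : 1 ≤ α / (2 * α - 2) := by
    rw [le_div_iff₀ (by linarith)]
    linarith
  refine tendsto_atTop_mono' _ ?_ ((tendsto_rpow_atTop hδ).comp tendsto_natCast_atTop_atTop)
  filter_upwards [h, eventually_ge_atTop 1] with d hd1 hd2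
  have hd : (1 : ℝ) ≤ d := by exact_mod_cast hd2
  rw [Function.comp, le_div_iff₀ (by linarith)]
  calc _ = (d : ℝ) ^ (δ + 1) := by rw [Real.rpow_add (by linarith), Real.rpow_one]
    _ ≤ (d : ℝ) ^ (α / (2 * α - 2) + δ) := Real.rpow_le_rpow_of_exponent_le hd (by linarith)
    _ ≤ _ := hd1.le

lemma tendsto_inv_sqrt_natCast {n : ℕ → ℕ} (hn : Tendsto n atTop atTop) :
    Tendsto (fun d => (√(n d : ℝ))⁻¹) atTop (𝓝 0) :=
  tendsto_inv_atTop_zero.comp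
    (Real.tendsto_sqrt_atTop.comp (tendsto_natCast_atTop_atTop.comp hn))

lemma tendsto_mul_inv_sqrt_sq {n : ℕ → ℕ} (hn : Tendsto n atTop atTop) :
    Tendsto (fun d => (n d : ℝ) * (√(n d : ℝ))⁻¹ ^ 2) atTop (𝓝 1) := by
  refine tendsto_const_nhds.congr' ?_
  filter_upwards [hn.eventually_gt_atTop 0] with d hd
  have : (0 : ℝ) < n d := Nat.cast_pos.2 hd
  rw [inv_pow, Real.sq_sqrt this.le, mul_inv_cancel₀ this.ne']

lemma tendsto_inv_sqrt_sq_mul_sq_div {n : ℕ → ℕ} (hn : Tendsto n atTop atTop) {c : ℝ}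
    (h : Tendsto (fun d : ℕ => (n d : ℝ) / d) atTop (𝓝 c)) :
    Tendsto (fun d : ℕ => (√(n d : ℝ))⁻¹ ^ 2 * (n d : ℝ) ^ 2 / d) atTop (𝓝 c) := by
  refine h.congr' ?_
  filter_upwards [hn.eventually_gt_atTop 0] with d hd
  have : (0 : ℝ) < n d := Nat.cast_pos.2 hd
  rw [inv_pow, Real.sq_sqrt this.le]
  field_simp

lemma inv_sqrt_two_mul_sq_div_sq (n d : ℕ) :
    (√(2 * (n : ℝ) ^ 2 / d))⁻¹ ^ 2 = d / (2 * n ^ 2) := by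
  rw [inv_pow, Real.sq_sqrt (by positivity), inv_div]

lemma tendsto_mul_inv_sqrt_two_mul_sq_div_sq {n : ℕ → ℕ} (hn : Tendsto n atTop atTop)
    (h : Tendsto (fun d : ℕ => (n d : ℝ) / d) atTop atTop) :
    Tendsto (fun d : ℕ => (n d : ℝ) * (√(2 * (n d : ℝ) ^ 2 / d))⁻¹ ^ 2) atTop (𝓝 0) := by
  have := (tendsto_inv_atTop_zero.comp h).div_const 2
  rw [zero_div] at this
  refine this.congr' ?_
  filter_upwards [hn.eventually_gt_atTop 0] with d hd
  have : (0 : ℝ) < n d := Nat.cast_pos.2 hd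
  rw [inv_sqrt_two_mul_sq_div_sq, Function.comp, inv_div]
  field_simp

lemma tendsto_inv_sqrt_two_mul_sq_div {n : ℕ → ℕ} (hn : Tendsto n atTop atTop)
    (h : Tendsto (fun d : ℕ => (n d : ℝ) / d) atTop atTop) :
    Tendsto (fun d : ℕ => (√(2 * (n d : ℝ) ^ 2 / d))⁻¹) atTop (𝓝 0) := by
  have hni : Tendsto (fun d => (n d : ℝ)⁻¹) atTop (𝓝 0) :=
    tendsto_inv_atTop_zero.comp (tendsto_natCast_atTop_atTop.comp hn)
  have := ((tendsto_mul_inv_sqrt_two_mul_sq_div_sq hn h).mul hni).sqrt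
  rw [mul_zero, Real.sqrt_zero] at this
  refine this.congr' ?_
  filter_upwards [hn.eventually_gt_atTop 0] with d hd
  have : (0 : ℝ) < n d := Nat.cast_pos.2 hd
  rw [mul_comm, ← mul_assoc, inv_mul_cancel₀ this.ne', one_mul,
    Real.sqrt_sq (inv_nonneg.2 (Real.sqrt_nonneg _))]

lemma tendsto_inv_sqrt_two_mul_sq_div_sq_mul {n : ℕ → ℕ} (hn : Tendsto n atTop atTop) :
    Tendsto (fun d : ℕ => (√(2 * (n d : ℝ) ^ 2 / d))⁻¹ ^ 2 * (n d : ℝ) ^ 2 / d) atTop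
      (𝓝 (1 / 2)) := by
  refine tendsto_const_nhds.congr' ?_
  filter_upwards [hn.eventually_gt_atTop 0, eventually_gt_atTop 0] with d hd hd'
  have : (0 : ℝ) < n d := Nat.cast_pos.2 hd
  have : (0 : ℝ) < d := Nat.cast_pos.2 hd'
  rw [inv_sqrt_two_mul_sq_div_sq]
  field_simp

/-- The central limit theorem for the squared norm when both weights agree. -/
theorem IsAxisWalkModel.convergesInLaw_div {Ω₀ Ω : Type*} [MeasurableSpace Ω₀] [MeasurableSpace Ω]
    {P₀ : Measure Ω₀} [IsProbabilityMeasure P₀] {P : Measure Ω} [IsProbabilityMeasure P]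
    {R₀ : Ω₀ → ℝ} {R : ℕ → Ω → ℝ} {V : (d : ℕ) → ℕ → Ω → EuclideanSpace ℝ (Fin d)}
    (h : IsAxisWalkModel P₀ P R₀ R V) {n : ℕ → ℕ} {c : ℕ → ℝ} {A Q : ℝ}
    (hn : Tendsto n atTop atTop) (ha : Tendsto (fun d => n d * (c d)⁻¹ ^ 2) atTop (𝓝 A))
    (hb : Tendsto (fun d : ℕ => (c d)⁻¹ ^ 2 * n d ^ 2 / d) atTop (𝓝 Q))
    (hb0 : Tendsto (fun d => (c d)⁻¹) atTop (𝓝 0)) (h4 : Integrable (fun ω => R₀ ω ^ 4) P₀) :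
    ConvergesInLaw P (fun d ω => (‖axisWalk R V d (n d) ω‖ ^ 2 - n d) / c d)
      (gaussianReal 0 (A * variance (fun ω => R₀ ω ^ 2) P₀ + 2 * Q).toNNReal) := by
  convert h.convergesInLaw_gaussianReal hn ha hb hb0 (Or.inl h4) using 3
  ring

end

/-! ### The regimes of the theorem -/

theorem mainTheorem11 {Ω₀ Ω : Type*} [MeasurableSpace Ω₀] [MeasurableSpace Ω]
    (P₀ : Measure Ω₀) [IsProbabilityMeasure P₀] (P : Measure Ω) [IsProbabilityMeasure P]
    (R₀ : Ω₀ → ℝ) (R : ℕ → Ω → ℝ) (V : (d : ℕ) → ℕ → Ω → EuclideanSpace ℝ (Fin d))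
    (hmodel : IsAxisWalkModel P₀ P R₀ R V)
    (n : ℕ → ℕ) (hn : Tendsto n atTop atTop) :
    -- the case of a finite fourth moment
    (Integrable (fun ω => R₀ ω ^ 4) P₀ →
      (Tendsto (fun d : ℕ => (n d : ℝ) / d) atTop (𝓝 0) →
        ConvergesInLaw P
          (fun d ω => (‖axisWalk R V d (n d) ω‖ ^ 2 - n d) / √(n d : ℝ))
          (gaussianReal 0 (variance (fun ω => R₀ ω ^ 2) P₀).toNNReal)) ∧
      (Tendsto (fun d : ℕ => (n d : ℝ) / d) atTop atTop →
        ConvergesInLaw P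
          (fun d ω => (‖axisWalk R V d (n d) ω‖ ^ 2 - n d) / √(2 * (n d : ℝ) ^ 2 / d))
          (gaussianReal 0 1)) ∧
      (∀ γ : ℝ, 0 < γ → (fun d : ℕ => (n d : ℝ)) ~[atTop] (fun d : ℕ => γ * (d : ℝ)) →
        ConvergesInLaw P
          (fun d ω => (‖axisWalk R V d (n d) ω‖ ^ 2 - n d) / √(n d : ℝ))
          (gaussianReal 0 (2 * γ + variance (fun ω => R₀ ω ^ 2) P₀).toNNReal))) ∧
    -- the case of `R²` in the domain of attraction of a stable law
    (∀ (α : ℝ) (L : ℝ → ℝ) (ζ : Measure ℝ) [IsProbabilityMeasure ζ],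
      1 < α → α < 2 → IsSlowlyVarying L → IsCenteredSpectrallyPositiveStable α ζ →
      ConvergesInLaw P
        (fun m ω => ((∑ i ∈ Finset.range m, R i ω ^ 2) - m) / ((m : ℝ) ^ (1 / α) * L m)) ζ →
      ((∃ δ : ℝ, 0 < δ ∧ ∀ᶠ d : ℕ in atTop, (d : ℝ) ^ (α / (2 * α - 2) + δ) < n d) →
        ConvergesInLaw P
          (fun d ω => (‖axisWalk R V d (n d) ω‖ ^ 2 - n d) / √(2 * (n d : ℝ) ^ 2 / d))
          (gaussianReal 0 1)) ∧
      ((∃ δ : ℝ, 0 < δ ∧ ∀ᶠ d : ℕ in atTop, (n d : ℝ) < (d : ℝ) ^ (α / (2 * α - 2) - δ)) →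
        ConvergesInLaw P
          (fun d ω => (‖axisWalk R V d (n d) ω‖ ^ 2 - n d) /
            ((n d : ℝ) ^ (1 / α) * L (n d))) ζ)) := by
  have hmeas : ∀ (d : ℕ) (c : ℝ),
      AEMeasurable (fun ω => (‖axisWalk R V d (n d) ω‖ ^ 2 - n d) / c) P := fun d c =>
    ((((hmodel.measurable_axisWalk d (n d)).norm.pow_const 2).sub_const _).div_const c).aemeasurable
  have hnr : Tendsto (fun d => (n d : ℝ)) atTop atTop := tendsto_natCast_atTop_atTop.comp hn
  refine ⟨fun h4 => ⟨fun h => ?_, fun h => ?_, fun γ hγ h => ?_⟩, ?_⟩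
  · have := hmodel.convergesInLaw_div hn (tendsto_mul_inv_sqrt_sq hn)
      (tendsto_inv_sqrt_sq_mul_sq_div hn h) (tendsto_inv_sqrt_natCast hn) h4
    simpa only [one_mul, mul_zero, add_zero] using this
  -- Here `A = 0` and `Q = 1 / 2`: the collision part alone supplies the unit variance.
  · have := hmodel.convergesInLaw_div hn (tendsto_mul_inv_sqrt_two_mul_sq_div_sq hn h)
      (tendsto_inv_sqrt_two_mul_sq_div_sq_mul hn) (tendsto_inv_sqrt_two_mul_sq_div hn h) h4
    have e : (0 * variance (fun ω => R₀ ω ^ 2) P₀ + 2 * (1 / 2)).toNNReal = 1 := by norm_num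
    simpa only [e] using this
  · have h' : Tendsto (fun d : ℕ => (n d : ℝ) / d) atTop (𝓝 γ) := by
      have hne : ∀ᶠ d : ℕ in atTop, γ * (d : ℝ) ≠ 0 := by
        filter_upwards [eventually_gt_atTop 0] with d hd
        have : (0 : ℝ) < d := Nat.cast_pos.2 hd
        positivity
      have := ((isEquivalent_iff_tendsto_one hne).1 h).mul_const γ
      rw [one_mul] at this
      refine this.congr' ?_
      filter_upwards [eventually_gt_atTop 0] with d hd
      have : (0 : ℝ) < d := Nat.cast_pos.2 hd
      simp only [Pi.div_apply]
      field_simp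
    have := hmodel.convergesInLaw_div hn (tendsto_mul_inv_sqrt_sq hn)
      (tendsto_inv_sqrt_sq_mul_sq_div hn h') (tendsto_inv_sqrt_natCast hn) h4
    simpa only [one_mul, add_comm] using this
  · intro α L ζ _ hα1 hα2 hL _ hconv
    refine ⟨fun ⟨δ, hδ, hlt⟩ => ?_, fun ⟨δ, hδ, hlt⟩ => ?_⟩
    · have h := tendsto_div_atTop_of_rpow_lt hα1 hα2 hδ hlt
      -- Weight `a = 0` isolates the collision part, whose normal limit needs no fourth moment of
      -- `R`.
      have hG := hmodel.convergesInLaw_gaussianReal (a := fun _ => 0) (A := 0) hn (by simp)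
        (tendsto_inv_sqrt_two_mul_sq_div_sq_mul hn) (tendsto_inv_sqrt_two_mul_sq_div hn h)
        (Or.inr fun _ => rfl)
      have e : (0 * variance (fun ω => R₀ ω ^ 2) P₀ + 2 * (1 / 2)).toNNReal = 1 := by norm_num
      simp only [e] at hG
      refine hG.of_sub (fun d => hmeas d _) ?_
      have hr := hL.tendsto_rpow_mul_div_sqrt hα1 hδ hn hlt
      -- The discarded part is the stably normalised sum of squares times the ratio of the two
      -- normalisations, which tends to zero.
      refine ((hconv.comp hn).tendstoInMeasure_mul hr).congr' ?_ EventuallyEq.rfl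
      filter_upwards [hnr.eventually hL.eventually_pos, hnr.eventually_gt_atTop 0] with d h1 h2
      refine ae_of_all _ fun ω => ?_
      have : (n d : ℝ) ^ (1 / α) * L (n d) ≠ 0 := by positivity
      simp only [Pi.sub_apply]
      field_simp
      ring
    · refine (hconv.comp hn).of_sub (fun d => hmeas d _) ?_
      have hq := (hL.tendsto_inv_rpow_mul_sq hα1 hδ hn hlt).const_mul 2
      rw [mul_zero] at hq
      set c : ℕ → ℝ := fun d => (n d : ℝ) ^ (1 / α) * L (n d) with hc
      -- Below the critical exponent the roles are exchanged: the collision part, of second moment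
      -- at most `2 n² / d`, vanishes in `L²` under the stable normalisation.
      have hU : TendstoInMeasure P (fun d ω => (c d)⁻¹ * (‖axisWalk R V d (n d) ω‖ ^ 2 -
          ∑ i ∈ Finset.range (n d), R i ω ^ 2)) atTop 0 := by
        refine tendstoInMeasure_zero_of_integral_sq ?_
          (squeeze_zero' (Eventually.of_forall fun d => integral_nonneg fun ω => sq_nonneg _) ?_ hq)
        · filter_upwards [eventually_gt_atTop 0] with d hd
          exact (hmodel.integral_norm_sq_sub_sum_sq_le ⟨0, hd⟩ (n d)).1.const_mul _
        · filter_upwards [eventually_gt_atTop 0] with d hd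
          simp only [mul_pow]
          rw [integral_const_mul]
          calc _ ≤ (c d)⁻¹ ^ 2 * (2 * ((n d : ℝ) ^ 2 / d)) := by
                gcongr
                exact (hmodel.integral_norm_sq_sub_sum_sq_le ⟨0, hd⟩ (n d)).2
            _ = _ := by ring
      refine hU.congr (fun d => ae_of_all _ fun ω => ?_) EventuallyEq.rfl
      simp only [Pi.sub_apply, hc]
      ring
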